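/- Let $D\subset\mathbb R^d$ be a bounded open set and let $M$ and $\widetilde M$ be two random Borel measures on $D$, defined on a common probability space $(\Omega,\mathcal F,P)$, with $M(D)<\infty$ and $\widetilde M(D)<\infty$ almost surely. Let $\Phi=(\Phi(x))_{x\in D}$ be a centered Gaussian field on $D$ defined on the same space that is independent of $M$ and independent of $\widetilde M$, and suppose that there are bounded measurable functions $\mathfrak h_k\colon D\to\mathbb R$, $k\ge 0$, such that $$\mathrm{Cov}\bigl(\Phi(x),\Phi(y)\bigr)=\sum_{k=0}^\infty \mathfrak h_k(x)\,\mathfrak h_k(y),$$ the partial sums converging locally uniformly in $(x,y)\in D\times D$. If $$\mathrm e^{\Phi(x)}M(\mathrm dx)\ \overset{\text{law}}=\ \mathrm e^{\Phi(x)}\widetilde M(\mathrm dx),$$ then $M\overset{\text{law}}=\widetilde M$. Here a random Borel measure is a random element of the space of Borel measures $\mu$ on $D$ with the $\sigma$-algebra generated by the maps $\mu\mapsto\mu(A)\in[0,\infty]$, $A\subset D$ Borel, and equality in law refers to this $\sigma$-algebra. The field $\Phi$ is called independent of $M$ if there is a sub-$\sigma$-algebra $\mathcal G\subset\mathcal F$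 independent of $M$ such that $(x,\omega)\mapsto\Phi(x)(\omega)$ is jointly measurable with respect to the product of the Borel $\sigma$-algebra of $D$ and $\mathcal G$ (for instance, when $\Phi$ is a jointly measurable field on one factor, and $M$ a random measure on the other factor, of a product probability space); likewise for $\widetilde M$. -/

import Mathlib

open MeasureTheory ProbabilityTheory Filter Topology
open scoped ENNReal

/-- The random field `Φ` on `X` is independent of the random element `M`: the whole random function
`(x, ω) ↦ Φ x ω` is a jointly measurable function of the space variable and of a source of
randomness (a sub-σ-algebra `𝒢`) that is independent of `M`.  For a field and a measure realized on
the two factors of a product probability space, `𝒢` is the σ-algebra of the first factor.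

Joint measurability is what gives the integrals of `x ↦ exp (Φ x ω)` a meaning; it has to hold
relative to `𝒢`, because independence of the coordinates `Φ x` alone (at countably many points `x`
at a time) would still allow the field to be changed on a random null set that depends on `M`. -/
def FieldIndep {Ω X E : Type*} [mΩ : MeasurableSpace Ω] [mX : MeasurableSpace X]
    [mE : MeasurableSpace E]
    (Φ : X → Ω → ℝ) (M : Ω → E) (P : Measure Ω) : Prop :=
  ∃ 𝒢 : MeasurableSpace Ω, 𝒢 ≤ mΩ ∧
    Measurable[mX.prod 𝒢] (fun (p : X × Ω) => Φ p.1 p.2) ∧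
    Indep 𝒢 (mE.comap M) P

/-- The random measure `e^{Φ(x)} M(dx)`, i.e. `A ↦ ∫_A e^{Φ(x)} M(dx)`. -/
noncomputable def expTilt {Ω X : Type*} [MeasurableSpace X]
    (Φ : X → Ω → ℝ) (M : Ω → Measure X) : Ω → Measure X :=
  fun ω => (M ω).withDensity fun x => ENNReal.ofReal (Real.exp (Φ x ω))

/-! The law of a random measure is determined by its Laplace functional `f ↦ E exp (-∫ f dM)`, so it
is enough to remove the Gaussian tilt from Laplace functionals. Tilted integrals may be infinite;
`expNeg` sends `∞` to `0` and keeps every expectation bounded by `1`.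

Conditionally on `M`, the Laplace functional of `e^Φ M` depends on the field only through its
finite-dimensional distributions (`SameFDD.integral_expNeg_eq`). Hence `Φ` may be replaced by an
explicit series `∑ h_k ξ_k` with i.i.d. standard Gaussian `ξ_k`, which is jointly measurable and can
be taken apart term by term.

Split off one term, `Φ = ξ h + R`. Let `u s` be the Laplace functional of `e^R M` at `f e^{s h}`,
and `v s` the one for the other measure. Applying the hypothesis to all test functions `f e^{s h}`
shows that `u` and `v` have the same convolution with the standard Gaussian law. This convolution is
injective on bounded continuous functions, because it is, up to an explicit factor, a moment
generating function (`eq_of_gaussian_convolution_eq`). So `u 0 = v 0`: the tilt by `ξ h` is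
cancelled (`tiltedLaplace_eq_of_split`).

After `n` cancellations the remaining field has variance `∑_{k ≥ n} h_k(x)²`, which tends to `0` at
each point. For bounded `f` supported where the full variance is bounded, its effect disappears in
the limit (`tendsto_integral_expNeg_of_variance_tendsto_zero`). Exhausting the space by such sets
gives equal untilted Laplace functionals, and `map_eq_map_of_laplace_eq` concludes. -/

/-! ### The exponential `exp (-a)` on `[0, ∞]` -/

/-- The function `a ↦ exp (-a)` on `[0, ∞]`, with `exp (-∞) = 0`. -/
noncomputable def expNeg (a : ℝ≥0∞) : ℝ := (EReal.exp (-(a : EReal))).toReal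

@[simp] lemma expNeg_top : expNeg ∞ = 0 := by simp [expNeg]

lemma expNeg_of_ne_top {a : ℝ≥0∞} (ha : a ≠ ∞) : expNeg a = Real.exp (-a.toReal) := by
  lift a to NNReal using ha
  have : -((a : ℝ≥0∞) : EReal) = ((-(a : ℝ) : ℝ) : EReal) := by
    rw [EReal.coe_neg]; rfl
  rw [expNeg, this, EReal.exp_coe, ENNReal.toReal_ofReal (Real.exp_pos _).le]
  simp

lemma expNeg_nonneg (a : ℝ≥0∞) : 0 ≤ expNeg a := ENNReal.toReal_nonneg

lemma expNeg_le_one (a : ℝ≥0∞) : expNeg a ≤ 1 := by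
  by_cases ha : a = ∞
  · simp [ha]
  · simp [expNeg_of_ne_top ha]

lemma norm_expNeg_le_one (a : ℝ≥0∞) : ‖expNeg a‖ ≤ 1 := by
  rw [Real.norm_of_nonneg (expNeg_nonneg a)]
  exact expNeg_le_one a

lemma expNeg_add (a b : ℝ≥0∞) : expNeg (a + b) = expNeg a * expNeg b := by
  by_cases ha : a = ∞
  · simp [ha]
  by_cases hb : b = ∞
  · simp [hb]
  rw [expNeg_of_ne_top ha, expNeg_of_ne_top hb, expNeg_of_ne_top (by simp [ha, hb]),
    ENNReal.toReal_add ha hb, ← Real.exp_add]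
  ring_nf

@[fun_prop]
lemma continuous_expNeg : Continuous expNeg := by
  have h : Continuous fun a : ℝ≥0∞ ↦ EReal.exp (-(a : EReal)) := 
    ENNReal.continuous_exp.comp (continuous_neg.comp continuous_coe_ennreal_ereal)
  refine ENNReal.continuousOn_toReal.comp_continuous h fun a ↦ ?_
  have : EReal.exp (-(a : EReal)) ≤ 1 := by simp [EReal.coe_ennreal_nonneg]
  exact ne_top_of_le_ne_top ENNReal.one_ne_top this

@[fun_prop]
lemma measurable_expNeg : Measurable expNeg := continuous_expNeg.measurable

lemma expNeg_injective : Function.Injective expNeg := by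
  intro a b h
  by_cases ha : a = ∞ <;> by_cases hb : b = ∞
  · rw [ha, hb]
  · rw [ha, expNeg_top, expNeg_of_ne_top hb] at h
    exact absurd h.symm (Real.exp_pos _).ne'
  · rw [hb, expNeg_top, expNeg_of_ne_top ha] at h
    exact absurd h (Real.exp_pos _).ne'
  · rw [expNeg_of_ne_top ha, expNeg_of_ne_top hb, Real.exp_eq_exp, neg_inj] at h
    exact (ENNReal.toReal_eq_toReal_iff' ha hb).mp h

lemma abs_expNeg_sub_expNeg_le {a b : ℝ≥0∞} (ha : a ≠ ∞) (hb : b ≠ ∞) :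
    |expNeg a - expNeg b| ≤ |a.toReal - b.toReal| := by
  rw [expNeg_of_ne_top ha, expNeg_of_ne_top hb]
  have key : ∀ s t : ℝ, 0 ≤ s → s ≤ t → |Real.exp (-s) - Real.exp (-t)| ≤ |s - t| := by
    intro s t hs hst
    rw [abs_of_nonneg (sub_nonneg.2 (Real.exp_le_exp.2 (by linarith))), abs_sub_comm,
      abs_of_nonneg (by linarith : 0 ≤ t - s)]
    have h1 : Real.exp (-t) = Real.exp (-s) * Real.exp (-(t - s)) := by
      rw [← Real.exp_add]; ring_nf
    have h2 : -(t - s) + 1 ≤ Real.exp (-(t - s)) := Real.add_one_le_exp _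
    have h3 : Real.exp (-s) ≤ 1 := by simpa using hs
    nlinarith [Real.exp_pos (-s)]
  rcases le_total a.toReal b.toReal with h | h
  · exact key _ _ ENNReal.toReal_nonneg h
  · rw [abs_sub_comm, abs_sub_comm a.toReal]
    exact key _ _ ENNReal.toReal_nonneg h

/-! ### Additive functionals of a field and its finite-dimensional distributions -/

lemma integral_exp_neg_eq_tsum {Ω : Type*} {mΩ : MeasurableSpace Ω} {P : Measure Ω}
    [IsProbabilityMeasure P] {Z : Ω → ℝ} (hZ : Measurable Z) {B : ℝ} (hB : ∀ ω, |Z ω| ≤ B) :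
    ∫ ω, Real.exp (-Z ω) ∂P = ∑' n : ℕ, (-1) ^ n / (n.factorial : ℝ) * ∫ ω, Z ω ^ n ∂P := by
  have hb : ∀ (n : ℕ) ω, ‖(-Z ω) ^ n / (n.factorial : ℝ)‖ ≤ B ^ n / n.factorial := fun n ω ↦ by
    rw [norm_div, norm_pow, norm_neg, Real.norm_eq_abs, Real.norm_natCast]
    exact div_le_div_of_nonneg_right (pow_le_pow_left₀ (abs_nonneg _) (hB ω) n) (by positivity)
  have hint : ∀ n : ℕ, Integrable (fun ω ↦ (-Z ω) ^ n / (n.factorial : ℝ)) P := fun n ↦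
    Integrable.of_bound (C := B ^ n / n.factorial) (by fun_prop) (.of_forall (hb n))
  have hs := hasSum_integral_of_summable_integral_norm hint ?_
  · have e : ∀ ω, ∑' n : ℕ, (-Z ω) ^ n / (n.factorial : ℝ) = Real.exp (-Z ω) := fun ω ↦ by
      rw [Real.exp_eq_exp_ℝ, NormedSpace.exp_eq_tsum_div]
    simp_rw [e] at hs
    rw [← hs.tsum_eq]
    congr with n
    rw [← integral_const_mul]
    congr with ω
    rw [neg_pow]; ring
  · refine Summable.of_nonneg_of_le (fun n ↦ integral_nonneg fun ω ↦ norm_nonneg _) (fun n ↦ ?_)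
      (Real.summable_pow_div_factorial B)
    simpa using integral_mono_of_nonneg (μ := P) (f := fun ω ↦ ‖(-Z ω) ^ n / (n.factorial : ℝ)‖)
      (g := fun _ ↦ B ^ n / n.factorial) (.of_forall fun ω ↦ norm_nonneg _)
      (integrable_const _) (.of_forall fun ω ↦ hb n ω)

/-- Bounded random variables with equal moments have the same expectation of `exp (-Z)`. -/
lemma integral_exp_neg_eq_of_moments {Ω Ω' : Type*} {mΩ : MeasurableSpace Ω}
    {mΩ' : MeasurableSpace Ω'} {P : Measure Ω} {P' : Measure Ω'} [IsProbabilityMeasure P]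
    [IsProbabilityMeasure P'] {Z : Ω → ℝ} {Z' : Ω' → ℝ} (hZ : Measurable Z) (hZ' : Measurable Z')
    {B : ℝ} (hB : ∀ ω, |Z ω| ≤ B) (hB' : ∀ ω, |Z' ω| ≤ B)
    (h : ∀ n : ℕ, ∫ ω, Z ω ^ n ∂P = ∫ ω, Z' ω ^ n ∂P') :
    ∫ ω, Real.exp (-Z ω) ∂P = ∫ ω, Real.exp (-Z' ω) ∂P' := by
  rw [integral_exp_neg_eq_tsum hZ hB, integral_exp_neg_eq_tsum hZ' hB']
  simp_rw [h]

lemma Measurable.comp₂ {α β γ δ : Type*} [MeasurableSpace α] [MeasurableSpace β]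
    [MeasurableSpace γ] [MeasurableSpace δ] {F : α → β → γ}
    (hF : Measurable (fun p : α × β ↦ F p.1 p.2)) {f : δ → α} {g : δ → β} (hf : Measurable f)
    (hg : Measurable g) : Measurable (fun x ↦ F (f x) (g x)) :=
  Measurable.comp (g := fun p : α × β ↦ F p.1 p.2) hF (hf.prodMk hg)

/-- Two random fields, possibly on different probability spaces, have the same finite dimensional
distributions. -/
def SameFDD {X Ω Ω' : Type*} [MeasurableSpace Ω] [MeasurableSpace Ω'] (Φ : X → Ω → ℝ)
    (Φ' : X → Ω' → ℝ) (P : Measure Ω) (P' : Measure Ω') : Prop :=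
  ∀ (n : ℕ) (x : Fin n → X),
    P.map (fun ω i ↦ Φ (x i) ω) = P'.map (fun ω i ↦ Φ' (x i) ω)

section fdd

variable {X Ω Ω' : Type*} [mX : MeasurableSpace X] [mΩ : MeasurableSpace Ω]
  [mΩ' : MeasurableSpace Ω'] {P : Measure Ω} {P' : Measure Ω'} [IsProbabilityMeasure P]
  [IsProbabilityMeasure P'] {Φ : X → Ω → ℝ} {Φ' : X → Ω' → ℝ}

/-- The `n`-th power of an integral is an integral over the `n`-fold product. By Fubini the
expectation moves inside, where only the joint law of `n` values of the field is left. -/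
lemma integral_pow_integral_comp_field (hΦ : Measurable (fun p : X × Ω ↦ Φ p.1 p.2))
    {g : X → ℝ → ℝ} (hg : Measurable (fun p : X × ℝ ↦ g p.1 p.2)) {K : ℝ}
    (hK : ∀ x y, |g x y| ≤ K) (μ : Measure X) [IsFiniteMeasure μ] (n : ℕ) :
    ∫ ω, (∫ x, g x (Φ x ω) ∂μ) ^ n ∂P =
      ∫ y, ∫ v, ∏ i, g (y i) (v i) ∂(P.map (fun ω (i : Fin n) ↦ Φ (y i) ω))
        ∂(Measure.pi fun _ : Fin n ↦ μ) := by
  have hm : Measurable fun p : Ω × (Fin n → X) ↦ ∏ i, g (p.2 i) (Φ (p.2 i) p.1) := by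
    refine Finset.measurable_fun_prod _ fun i _ ↦ ?_
    have h1 : Measurable fun p : Ω × (Fin n → X) ↦ p.2 i := by fun_prop
    exact hg.comp₂ h1 (hΦ.comp₂ h1 measurable_fst)
  calc ∫ ω, (∫ x, g x (Φ x ω) ∂μ) ^ n ∂P
      = ∫ ω, ∫ y, ∏ i, g (y i) (Φ (y i) ω) ∂(Measure.pi fun _ : Fin n ↦ μ) ∂P := by
        congr with ω
        rw [integral_fintype_prod_eq_pow (ι := Fin n) (fun x ↦ g x (Φ x ω)), Fintype.card_fin]
    _ = ∫ y, ∫ ω, ∏ i, g (y i) (Φ (y i) ω) ∂P ∂(Measure.pi fun _ : Fin n ↦ μ) := by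
        refine integral_integral_swap (Integrable.of_bound (C := K ^ n) hm.aestronglyMeasurable
          (.of_forall fun p ↦ ?_))
        simp only [Function.uncurry]
        rw [norm_prod]
        calc _ ≤ ∏ _i : Fin n, K := Finset.prod_le_prod (fun _ _ ↦ norm_nonneg _) fun i _ ↦ hK _ _
          _ = K ^ n := by simp
    _ = _ := by
        congr with y
        have h1 : Measurable (fun ω (i : Fin n) ↦ Φ (y i) ω) :=
          measurable_pi_lambda _ fun i ↦ hΦ.comp₂ measurable_const measurable_id
        rw [integral_map h1.aemeasurable]
        refine Measurable.aestronglyMeasurable (Finset.measurable_fun_prod _ fun i _ ↦ ?_)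
        exact hg.comp₂ measurable_const (measurable_pi_apply i)

/-- Truncation at `K` makes the functional bounded, so that its moments determine its Laplace
transform. Monotone convergence inside `expNeg` and dominated convergence outside remove the
truncation. -/
lemma tendsto_integral_expNeg_min (hΦ : Measurable (fun p : X × Ω ↦ Φ p.1 p.2))
    {F : X → ℝ → ℝ≥0∞} (hF : Measurable (fun p : X × ℝ ↦ F p.1 p.2))
    (μ : Measure X) [IsFiniteMeasure μ] :
    Tendsto (fun K : ℕ ↦ ∫ ω, Real.exp (-∫ x, (min (F x (Φ x ω)) K).toReal ∂μ) ∂P) atTop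
      (𝓝 (∫ ω, expNeg (∫⁻ x, F x (Φ x ω) ∂μ) ∂P)) := by
  have hm : ∀ (K : ℕ) ω, Measurable fun x ↦ min (F x (Φ x ω)) (K : ℝ≥0∞) := fun K ω ↦
    (hF.comp₂ measurable_id (hΦ.comp₂ measurable_id measurable_const)).min measurable_const
  have hlim : Tendsto (fun K : ℕ ↦ ∫ ω, expNeg (∫⁻ x, min (F x (Φ x ω)) K ∂μ) ∂P) atTop
      (𝓝 (∫ ω, expNeg (∫⁻ x, F x (Φ x ω) ∂μ) ∂P)) := by
    refine tendsto_integral_of_dominated_convergence (fun _ ↦ 1) (fun K ↦ ?_)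
      (integrable_const _) (fun K ↦ .of_forall fun ω ↦ norm_expNeg_le_one _)
      (.of_forall fun ω ↦ (continuous_expNeg.tendsto _).comp ?_)
    · refine Measurable.aestronglyMeasurable (measurable_expNeg.comp ?_)
      refine Measurable.lintegral_prod_left'
        (f := fun p : X × Ω ↦ min (F p.1 (Φ p.1 p.2)) (K : ℝ≥0∞)) ?_
      exact (hF.comp₂ measurable_fst hΦ).min measurable_const
    · refine lintegral_tendsto_of_tendsto_of_monotone (fun K ↦ (hm K ω).aemeasurable)
        (.of_forall fun x K L hKL ↦ min_le_min_left _ (by exact_mod_cast hKL))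
        (.of_forall fun x ↦ ?_)
      have : Tendsto (fun K : ℕ ↦ min (F x (Φ x ω)) (K : ℝ≥0∞)) atTop
          (𝓝 (min (F x (Φ x ω)) ∞)) :=
        tendsto_const_nhds.min ENNReal.tendsto_nat_nhds_top
      simpa using this
  refine hlim.congr fun K ↦ ?_
  congr with ω
  rw [integral_toReal (hm K ω).aemeasurable
    (.of_forall fun x ↦ (min_le_right _ _).trans_lt (by simp)), expNeg_of_ne_top]
  refine ne_top_of_le_ne_top (ENNReal.mul_ne_top (ENNReal.natCast_ne_top K)
    (measure_ne_top μ Set.univ)) ?_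
  rw [← lintegral_const]
  exact lintegral_mono fun x ↦ min_le_right _ _

/-- The Laplace transform of an additive functional of a jointly measurable field depends only on
the finite dimensional distributions of the field. -/
theorem SameFDD.integral_expNeg_eq (h : SameFDD Φ Φ' P P')
    (hΦ : Measurable (fun p : X × Ω ↦ Φ p.1 p.2)) (hΦ' : Measurable (fun p : X × Ω' ↦ Φ' p.1 p.2))
    {F : X → ℝ → ℝ≥0∞} (hF : Measurable (fun p : X × ℝ ↦ F p.1 p.2))
    (μ : Measure X) [IsFiniteMeasure μ] :
    ∫ ω, expNeg (∫⁻ x, F x (Φ x ω) ∂μ) ∂P = ∫ ω, expNeg (∫⁻ x, F x (Φ' x ω) ∂μ) ∂P' := by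
  refine tendsto_nhds_unique (tendsto_integral_expNeg_min hΦ hF μ) ?_
  refine (tendsto_integral_expNeg_min hΦ' hF μ).congr fun K ↦ ?_
  have hg : Measurable (fun p : X × ℝ ↦ (min (F p.1 p.2) K).toReal) :=
    (hF.min measurable_const).ennreal_toReal
  have hK : ∀ x y, |(min (F x y) (K : ℝ≥0∞)).toReal| ≤ K := fun x y ↦ by
    rw [abs_of_nonneg ENNReal.toReal_nonneg]
    exact ENNReal.toReal_le_of_le_ofReal (by simp) ((min_le_right _ _).trans (by simp))
  refine (integral_exp_neg_eq_of_moments (B := K * μ.real Set.univ) ?_ ?_ (fun ω ↦ ?_)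
    (fun ω ↦ ?_) fun n ↦ ?_).symm
  · exact (StronglyMeasurable.integral_prod_left'
      (f := fun p : X × Ω ↦ (min (F p.1 (Φ p.1 p.2)) K).toReal)
      (hg.comp₂ (F := fun x y ↦ (min (F x y) K).toReal)
        measurable_fst hΦ).stronglyMeasurable).measurable
  · exact (StronglyMeasurable.integral_prod_left'
      (f := fun p : X × Ω' ↦ (min (F p.1 (Φ' p.1 p.2)) K).toReal)
      (hg.comp₂ (F := fun x y ↦ (min (F x y) K).toReal)
        measurable_fst hΦ').stronglyMeasurable).measurable
  · exact norm_integral_le_of_norm_le_const (.of_forall fun x ↦ (Real.norm_eq_abs _).trans_le (hK x _))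
  · exact norm_integral_le_of_norm_le_const (.of_forall fun x ↦ (Real.norm_eq_abs _).trans_le (hK x _))
  · rw [integral_pow_integral_comp_field hΦ (g := fun x y ↦ (min (F x y) K).toReal) hg hK,
      integral_pow_integral_comp_field hΦ' (g := fun x y ↦ (min (F x y) K).toReal) hg hK]
    simp_rw [h n]

end fdd

/-! ### Centered Gaussian fields through characteristic functions -/

/-- The field `Φ` is centered Gaussian with covariance `C`, expressed through characteristic
functions of its linear combinations. -/
def IsCenteredGaussianField {X Ω : Type*} [MeasurableSpace Ω] (Φ : X → Ω → ℝ) (P : Measure Ω)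
    (C : X → X → ℝ) : Prop :=
  ∀ (n : ℕ) (x : Fin n → X) (t : Fin n → ℝ),
    ∫ ω, Complex.exp (((∑ i, t i * Φ (x i) ω : ℝ) : ℂ) * Complex.I) ∂P =
      Complex.exp (-((∑ i, ∑ j, t i * t j * C (x i) (x j) : ℝ) : ℂ) / 2)

section

variable {X Ω Ω' : Type*} [mΩ : MeasurableSpace Ω]
  [mΩ' : MeasurableSpace Ω'] {P : Measure Ω} {P' : Measure Ω'} {Φ : X → Ω → ℝ} {Φ' : X → Ω' → ℝ} {C : X → X → ℝ}

/-- A functional on `ℝⁿ` is given by its values on the basis vectors; this turns characteristic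
functions of vectors into those of the linear combinations in `IsCenteredGaussianField`. -/
lemma charFunDual_map_fin {n : ℕ} {Y : Fin n → Ω → ℝ} (hY : ∀ i, Measurable (Y i))
    (L : StrongDual ℝ (Fin n → ℝ)) :
    charFunDual (P.map fun ω i ↦ Y i ω) L =
      ∫ ω, Complex.exp (((∑ i, L (Pi.single i 1) * Y i ω : ℝ) : ℂ) * Complex.I) ∂P := by
  rw [charFunDual_apply, integral_map (by fun_prop) (by fun_prop)]
  congr with ω
  congr 3
  conv_lhs => rw [← Finset.univ_sum_single (fun i ↦ Y i ω)]
  rw [map_sum]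
  refine Finset.sum_congr rfl fun i _ ↦ ?_
  have : (Pi.single i (Y i ω) : Fin n → ℝ) = Y i ω • Pi.single i 1 := by
    rw [← Pi.single_smul]; simp
  rw [this, map_smul, smul_eq_mul, mul_comm]

variable [IsProbabilityMeasure P] [IsProbabilityMeasure P']

lemma IsCenteredGaussianField.sameFDD (h : IsCenteredGaussianField Φ P C)
    (h' : IsCenteredGaussianField Φ' P' C) (hΦ : ∀ x, Measurable (Φ x))
    (hΦ' : ∀ x, Measurable (Φ' x)) : SameFDD Φ Φ' P P' := by
  intro n x
  have : IsProbabilityMeasure (P.map fun ω i ↦ Φ (x i) ω) :=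
    Measure.isProbabilityMeasure_map (by fun_prop)
  have : IsProbabilityMeasure (P'.map fun ω i ↦ Φ' (x i) ω) :=
    Measure.isProbabilityMeasure_map (by fun_prop)
  refine Measure.ext_of_charFunDual ?_
  ext L
  rw [charFunDual_map_fin (fun i ↦ hΦ (x i)), charFunDual_map_fin (fun i ↦ hΦ' (x i)), h, h']

lemma IsCenteredGaussianField.map_eq_gaussianReal (h : IsCenteredGaussianField Φ P C) (x : X)
    (hx : 0 ≤ C x x) (hΦ : Measurable (Φ x)) :
    P.map (Φ x) = gaussianReal 0 (C x x).toNNReal := by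
  have : IsProbabilityMeasure (P.map (Φ x)) := Measure.isProbabilityMeasure_map (by fun_prop)
  refine Measure.ext_of_charFun ?_
  ext t
  rw [charFun_apply_real, charFun_gaussianReal, integral_map (by fun_prop) (by fun_prop)]
  have := h 1 (fun _ ↦ x) (fun _ ↦ t)
  simp only [Finset.univ_unique, Finset.sum_singleton] at this
  push_cast at this
  rw [this]
  congr 1
  rw [Real.coe_toNNReal _ hx]
  push_cast
  ring

lemma IsCenteredGaussianField.of_isGaussianProcess (hΦ : IsGaussianProcess Φ P)
    (h0 : ∀ x, ∫ ω, Φ x ω ∂P = 0) :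
    IsCenteredGaussianField Φ P (fun x y ↦ cov[Φ x, Φ y; P]) := by
  classical
  intro n x t
  have hmem : ∀ i, MemLp (Φ (x i)) 2 P := fun i ↦ (hΦ.hasGaussianLaw_eval (x i)).memLp_two
  set Y : Ω → ℝ := fun ω ↦ ∑ i, t i * Φ (x i) ω with hY
  have hg : HasGaussianLaw Y P := by
    let I : Finset X := Finset.univ.image x
    have hI : ∀ i, x i ∈ I := fun i ↦ Finset.mem_image_of_mem _ (Finset.mem_univ i)
    have := (hΦ.hasGaussianLaw I).map_fun
      (∑ i, t i • ContinuousLinearMap.proj (R := ℝ) (φ := fun _ : I ↦ ℝ) ⟨x i, hI i⟩)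
    simpa using this
  have hmean : ∫ ω, Y ω ∂P = 0 := by
    rw [hY, integral_finsetSum _ fun i _ ↦ ((hmem i).integrable (by norm_num)).const_mul _]
    simp [integral_const_mul, h0]
  have hvar : Var[Y; P] = ∑ i, ∑ j, t i * t j * cov[Φ (x i), Φ (x j); P] := by
    rw [← covariance_self hg.aemeasurable, hY,
      covariance_fun_sum_fun_sum (fun i ↦ (hmem i).const_mul _) (fun i ↦ (hmem i).const_mul _)]
    refine Finset.sum_congr rfl fun i _ ↦ Finset.sum_congr rfl fun j _ ↦ ?_
    rw [covariance_const_mul_left, covariance_const_mul_right]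
    ring
  have h1 := hg.charFunDual_map_eq_fun (L := ContinuousLinearMap.id ℝ ℝ)
  rw [charFunDual_apply, integral_map hg.aemeasurable (by fun_prop)] at h1
  simp only [ContinuousLinearMap.id_apply] at h1
  rw [h1, hmean, hvar]
  congr 1
  push_cast
  ring

/-- Adding an independent standard Gaussian multiple of `h` to a Gaussian field. -/
lemma IsCenteredGaussianField.prod_add (hΦ : IsCenteredGaussianField Φ P C) (h : X → ℝ) :
    IsCenteredGaussianField (fun x (p : ℝ × Ω) ↦ p.1 * h x + Φ x p.2)
      ((gaussianReal 0 1).prod P) (fun x y ↦ h x * h y + C x y) := by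
  intro n x t
  have e : ∀ p : ℝ × Ω, Complex.exp (((∑ i, t i * (p.1 * h (x i) + Φ (x i) p.2) : ℝ) : ℂ)
      * Complex.I) = Complex.exp (((∑ i, t i * h (x i) : ℝ) : ℂ) * p.1 * Complex.I) *
      Complex.exp (((∑ i, t i * Φ (x i) p.2 : ℝ) : ℂ) * Complex.I) := fun p ↦ by
    rw [← Complex.exp_add, ← add_mul]
    congr 2
    rw [← Complex.ofReal_mul, ← Complex.ofReal_add, Finset.sum_mul, ← Finset.sum_add_distrib]
    congr 1
    exact Finset.sum_congr rfl fun i _ ↦ by ring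
  simp_rw [e]
  rw [integral_prod_mul (fun s : ℝ ↦ Complex.exp (((∑ i, t i * h (x i) : ℝ) : ℂ) * s * Complex.I))
    (fun ω ↦ Complex.exp (((∑ i, t i * Φ (x i) ω : ℝ) : ℂ) * Complex.I)), hΦ,
    ← charFun_apply_real, charFun_gaussianReal, ← Complex.exp_add]
  congr 1
  have : ∑ i, ∑ j, t i * t j * (h (x i) * h (x j) + C (x i) (x j)) =
      (∑ i, t i * h (x i)) ^ 2 + ∑ i, ∑ j, t i * t j * C (x i) (x j) := by
    rw [sq, Finset.sum_mul_sum, ← Finset.sum_add_distrib]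
    refine Finset.sum_congr rfl fun i _ ↦ ?_
    rw [← Finset.sum_add_distrib]
    exact Finset.sum_congr rfl fun j _ ↦ by ring
  rw [this]
  push_cast
  ring

end

/-! ### Construction of the field as a random series -/

/-- The law of an i.i.d. sequence of standard Gaussian variables. -/
noncomputable abbrev gaussianSeq : Measure (ℕ → ℝ) := Measure.infinitePi fun _ ↦ gaussianReal 0 1

lemma iIndepFun_mul_gaussianSeq (a : ℕ → ℝ) :
    iIndepFun (fun k (ω : ℕ → ℝ) ↦ a k * ω k) gaussianSeq :=
  iIndepFun_infinitePi (X := fun k (y : ℝ) ↦ a k * y) (fun k ↦ by fun_prop)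

lemma map_eval_gaussianSeq (k : ℕ) : gaussianSeq.map (fun ω ↦ ω k) = gaussianReal 0 1 :=
  Measure.infinitePi_map_eval _ k

lemma memLp_eval_gaussianSeq (k : ℕ) : MemLp (fun ω : ℕ → ℝ ↦ ω k) 2 gaussianSeq := by
  have : MemLp id 2 (gaussianSeq.map (fun ω ↦ ω k)) := by
    rw [map_eval_gaussianSeq]
    exact memLp_id_gaussianReal 2
  exact this.comp_of_map (measurable_pi_apply k).aemeasurable

lemma integral_eval_gaussianSeq (k : ℕ) : ∫ ω, ω k ∂gaussianSeq = 0 := by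
  have := integral_map (μ := gaussianSeq) (φ := fun ω ↦ ω k) (f := id)
    (measurable_pi_apply k).aemeasurable (by fun_prop)
  rw [map_eval_gaussianSeq] at this
  simpa using this.symm

lemma variance_eval_gaussianSeq (k : ℕ) : Var[fun ω ↦ ω k; gaussianSeq] = 1 := by
  have := variance_map (μ := gaussianSeq) (Y := fun ω ↦ ω k) (X := id)
    (by fun_prop) (measurable_pi_apply k).aemeasurable
  rw [map_eval_gaussianSeq, variance_id_gaussianReal] at this
  simpa using this.symm

/-- A series of independent centered Gaussian variables with summable variances converges almost
surely. -/
lemma ae_exists_tendsto_gaussian_series {a : ℕ → ℝ} (ha : Summable fun k ↦ a k ^ 2) :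
    ∀ᵐ ω ∂gaussianSeq, ∃ c, Tendsto (fun n ↦ ∑ k ∈ Finset.range n, a k * ω k) atTop (𝓝 c) := by
  let X : ℕ → (ℕ → ℝ) → ℝ := fun k ω ↦ a k * ω k
  have hXm : ∀ k, Measurable (X k) := fun k ↦ by fun_prop
  have hXs : ∀ k, StronglyMeasurable (X k) := fun k ↦ (hXm k).stronglyMeasurable
  have hX2 : ∀ k, MemLp (X k) 2 gaussianSeq := fun k ↦ (memLp_eval_gaussianSeq k).const_mul _
  have hXi : iIndepFun X gaussianSeq := iIndepFun_mul_gaussianSeq a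
  have hX0 : ∀ k, ∫ ω, X k ω ∂gaussianSeq = 0 := fun k ↦ by
    simp only [X, integral_const_mul, integral_eval_gaussianSeq, mul_zero]
  let ℱ := Filtration.natural X hXs
  -- The sum includes the index `n`, so `S n` is adapted to the natural filtration at time `n`. This
  -- martingale is bounded in `L²`, hence in `L¹`, and converges almost surely.
  let S : ℕ → (ℕ → ℝ) → ℝ := fun n ↦ ∑ k ∈ Finset.range (n + 1), X k
  have hS2 : ∀ n, MemLp (S n) 2 gaussianSeq := fun n ↦ memLp_finsetSum' _ fun k _ ↦ hX2 k
  have hS0 : ∀ n, ∫ ω, S n ω ∂gaussianSeq = 0 := fun n ↦ by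
    simp only [S, Finset.sum_apply]
    rw [integral_finsetSum _ fun i _ ↦ (hX2 i).integrable (by norm_num)]
    simp [hX0]
  have hmart : Martingale S ℱ gaussianSeq := by
    refine martingale_of_condExp_sub_eq_zero_nat (fun n ↦ ?_)
      (fun n ↦ (hS2 n).integrable (by norm_num)) fun n ↦ ?_
    · refine Finset.stronglyMeasurable_sum _ fun k hk ↦ ?_
      exact (Filtration.stronglyAdapted_natural hXs k).mono
        (ℱ.mono (Nat.lt_succ_iff.1 (Finset.mem_range.1 hk)))
    · have : S (n + 1) - S n = X (n + 1) := by
        simp only [S]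
        rw [Finset.sum_range_succ _ (n + 1), add_sub_cancel_left]
      rw [this]
      refine (iIndepFun.condExp_natural_ae_eq_of_lt hXs hXi n.lt_succ_self).trans ?_
      simp only [hX0]
      rfl
  have hvar : ∀ n, Var[S n; gaussianSeq] = ∑ k ∈ Finset.range (n + 1), a k ^ 2 := fun n ↦ by
    rw [IndepFun.variance_sum (fun k _ ↦ hX2 k) fun i _ j _ hij ↦ hXi.indepFun hij]
    refine Finset.sum_congr rfl fun k _ ↦ ?_
    rw [variance_const_mul, variance_eval_gaussianSeq, mul_one]
  have hbdd : ∀ n, eLpNorm (S n) 1 gaussianSeq ≤ (NNReal.sqrt (∑' k, a k ^ 2).toNNReal : ℝ≥0∞) := by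
    intro n
    refine (eLpNorm_le_eLpNorm_of_exponent_le (by norm_num : (1 : ℝ≥0∞) ≤ 2)
      (hS2 n).aestronglyMeasurable).trans ?_
    have h1 : ∫ ω, S n ω ^ 2 ∂gaussianSeq = ∑ k ∈ Finset.range (n + 1), a k ^ 2 := by
      rw [← hvar, variance_of_integral_eq_zero (hS2 n).aestronglyMeasurable.aemeasurable (hS0 n)]
    rw [MemLp.eLpNorm_eq_integral_rpow_norm (by norm_num) (by norm_num) (hS2 n)]
    simp only [ENNReal.toReal_ofNat, Real.rpow_ofNat, Real.norm_eq_abs, sq_abs, h1]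
    rw [← one_div, ← Real.sqrt_eq_rpow, ← ENNReal.ofReal_coe_nnreal, Real.coe_sqrt]
    refine ENNReal.ofReal_le_ofReal (Real.sqrt_le_sqrt ?_)
    rw [Real.coe_toNNReal _ (tsum_nonneg fun k ↦ sq_nonneg _)]
    exact ha.sum_le_tsum _ fun k _ ↦ sq_nonneg _
  filter_upwards [hmart.submartingale.exists_ae_tendsto_of_bdd hbdd] with ω ⟨c, hc⟩
  refine ⟨c, (tendsto_add_atTop_iff_nat 1).1 ?_⟩
  simpa [S, X, Finset.sum_apply] using hc

lemma integral_exp_gaussian_sum (a : ℕ → ℝ) (n : ℕ) :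
    ∫ ω, Complex.exp (((∑ k ∈ Finset.range n, a k * ω k : ℝ) : ℂ) * Complex.I) ∂gaussianSeq =
      Complex.exp (-((∑ k ∈ Finset.range n, a k ^ 2 : ℝ) : ℂ) / 2) := by
  have hi : iIndepFun (fun (k : Fin n) (ω : ℕ → ℝ) ↦ a k * ω k) gaussianSeq :=
    (iIndepFun_mul_gaussianSeq a).precomp Fin.val_injective
  have := hi.integral_fun_prod_comp (f := fun _ (y : ℝ) ↦ Complex.exp (y * Complex.I))
    (fun k ↦ Measurable.aemeasurable (by fun_prop)) (fun k ↦ by fun_prop)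
  calc _ = ∫ ω, ∏ k : Fin n, Complex.exp ((a k * ω k : ℝ) * Complex.I) ∂gaussianSeq := by
        congr with ω
        rw [← Complex.exp_sum, ← Finset.sum_mul, ← Complex.ofReal_sum, Finset.sum_range]
    _ = ∏ k : Fin n, Complex.exp (-((a k ^ 2 : ℝ) : ℂ) / 2) := by
        rw [this]
        refine Finset.prod_congr rfl fun k _ ↦ ?_
        have h1 := charFun_apply_real (μ := gaussianReal 0 1) (a k)
        rw [charFun_gaussianReal, ← map_eval_gaussianSeq k,
          integral_map (measurable_pi_apply _).aemeasurable (by fun_prop)] at h1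
        push_cast at h1 ⊢
        rw [← h1]
        congr 1
        ring
    _ = _ := by
        rw [← Complex.exp_sum, Finset.sum_range]
        congr 1
        push_cast
        rw [← Finset.sum_div, Finset.sum_neg_distrib]

/-- A jointly measurable Gaussian field with covariance `∑ k, h k x * h k y`. -/
noncomputable def gaussianSeries {X : Type*} (h : ℕ → X → ℝ) (x : X) (ω : ℕ → ℝ) : ℝ :=
  limUnder atTop fun n ↦ ∑ k ∈ Finset.range n, h k x * ω k

lemma measurable_gaussianSeries {X : Type*} [MeasurableSpace X] {h : ℕ → X → ℝ}
    (hh : ∀ k, Measurable (h k)) :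
    Measurable (fun p : X × (ℕ → ℝ) ↦ gaussianSeries h p.1 p.2) := by
  refine StronglyMeasurable.measurable (StronglyMeasurable.limUnder fun n ↦ ?_)
  exact Measurable.stronglyMeasurable (by fun_prop)

lemma summable_mul_of_summable_sq {a b : ℕ → ℝ} (ha : Summable fun k ↦ a k ^ 2)
    (hb : Summable fun k ↦ b k ^ 2) : Summable fun k ↦ a k * b k := by
  refine Summable.of_norm_bounded (ha.add hb) fun k ↦ ?_
  rw [Real.norm_eq_abs, abs_mul]
  nlinarith [sq_nonneg (|a k| - |b k|), sq_abs (a k), sq_abs (b k), sq_nonneg (a k),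
    sq_nonneg (b k)]

theorem isCenteredGaussianField_gaussianSeries {X : Type*} {h : ℕ → X → ℝ}
    (hs : ∀ x, Summable fun k ↦ h k x ^ 2) :
    IsCenteredGaussianField (gaussianSeries h) gaussianSeq (fun x y ↦ ∑' k, h k x * h k y) := by
  intro n x t
  -- Where the series diverges, `limUnder` returns a default value; for finitely many points this
  -- happens only on a null set.
  have hlim : ∀ᵐ ω ∂gaussianSeq, ∀ i, Tendsto (fun N ↦ ∑ k ∈ Finset.range N, h k (x i) * ω k)
      atTop (𝓝 (gaussianSeries h (x i) ω)) := by
    rw [ae_all_iff]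
    intro i
    filter_upwards [ae_exists_tendsto_gaussian_series (hs (x i))] with ω hω
    exact tendsto_nhds_limUnder hω
  let a : ℕ → ℝ := fun k ↦ ∑ i, t i * h k (x i)
  have ea : ∀ N (ω : ℕ → ℝ), ∑ i, t i * ∑ k ∈ Finset.range N, h k (x i) * ω k =
      ∑ k ∈ Finset.range N, a k * ω k := fun N ω ↦ by
    simp only [a, Finset.mul_sum, Finset.sum_mul]
    rw [Finset.sum_comm]
    exact Finset.sum_congr rfl fun k _ ↦ Finset.sum_congr rfl fun i _ ↦ by ring
  have h1 : Tendsto (fun N ↦ ∫ ω, Complex.exp (((∑ k ∈ Finset.range N, a k * ω k : ℝ) : ℂ)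
      * Complex.I) ∂gaussianSeq) atTop
      (𝓝 (∫ ω, Complex.exp (((∑ i, t i * gaussianSeries h (x i) ω : ℝ) : ℂ) * Complex.I)
        ∂gaussianSeq)) := by
    refine tendsto_integral_of_dominated_convergence (fun _ ↦ 1)
      (fun N ↦ Measurable.aestronglyMeasurable (by fun_prop)) (integrable_const _)
      (fun N ↦ .of_forall fun ω ↦ (Complex.norm_exp_ofReal_mul_I _).le) ?_
    filter_upwards [hlim] with ω hω
    have h2 : Tendsto (fun N ↦ ∑ k ∈ Finset.range N, a k * ω k) atTop
        (𝓝 (∑ i, t i * gaussianSeries h (x i) ω)) := by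
      simp_rw [← ea]
      exact tendsto_finsetSum _ fun i _ ↦ (hω i).const_mul _
    have h3 : Continuous fun y : ℝ ↦ Complex.exp ((y : ℂ) * Complex.I) := by fun_prop
    exact (h3.tendsto _).comp h2
  refine tendsto_nhds_unique h1 ?_
  simp_rw [integral_exp_gaussian_sum]
  have hsum : HasSum (fun k ↦ a k ^ 2)
      (∑ i, ∑ j, t i * t j * ∑' k, h k (x i) * h k (x j)) := by
    have : ∀ k, a k ^ 2 = ∑ i, ∑ j, t i * t j * (h k (x i) * h k (x j)) := fun k ↦ by
      simp only [a]
      rw [sq, Finset.sum_mul_sum]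
      exact Finset.sum_congr rfl fun i _ ↦ Finset.sum_congr rfl fun j _ ↦ by ring
    simp_rw [this]
    exact hasSum_sum fun i _ ↦ hasSum_sum fun j _ ↦
      ((summable_mul_of_summable_sq (hs (x i)) (hs (x j))).hasSum.mul_left _)
  have h3 : Continuous fun y : ℝ ↦ Complex.exp (-(y : ℂ) / 2) := by fun_prop
  exact (h3.tendsto _).comp hsum.tendsto_sum_nat

/-! ### Injectivity of Gaussian convolution -/

/-- Translate by `s` and complete the square: the one-dimensional Cameron–Martin formula. -/
lemma integral_exp_mul_gaussianReal (u : ℝ → ℝ) (s : ℝ) :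
    ∫ t, Real.exp (s * t) * u t ∂(gaussianReal 0 1) =
      Real.exp (s ^ 2 / 2) * ∫ t, u (s + t) ∂(gaussianReal 0 1) := by
  rw [integral_gaussianReal_eq_integral_smul one_ne_zero,
    integral_gaussianReal_eq_integral_smul one_ne_zero, ← integral_const_mul,
    ← integral_add_left_eq_self _ s]
  congr with t
  simp only [smul_eq_mul, gaussianPDFReal]
  have : Real.exp (-(s + t - 0) ^ 2 / (2 * ((1 : NNReal) : ℝ))) * Real.exp (s * (s + t)) =
      Real.exp (s ^ 2 / 2) * Real.exp (-(t - 0) ^ 2 / (2 * ((1 : NNReal) : ℝ))) := by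
    rw [← Real.exp_add, ← Real.exp_add]
    congr 1
    push_cast
    ring
  linear_combination ((√(2 * Real.pi * ((1 : NNReal) : ℝ)))⁻¹ * u (s + t)) * this

/-- Convolution with the standard Gaussian law is injective on `[0, 1]`-valued continuous
functions. -/
theorem eq_of_gaussian_convolution_eq {u v : ℝ → ℝ} (hu : Continuous u) (hv : Continuous v)
    (hu0 : ∀ t, 0 ≤ u t) (hv0 : ∀ t, 0 ≤ v t) (hu1 : ∀ t, u t ≤ 1) (hv1 : ∀ t, v t ≤ 1)
    (h : ∀ s, ∫ t, u (s + t) ∂(gaussianReal 0 1) = ∫ t, v (s + t) ∂(gaussianReal 0 1)) :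
    u = v := by
  set γ := gaussianReal 0 1 with hγ
  have hfin : ∀ w : ℝ → ℝ, (∀ t, w t ≤ 1) →
      IsFiniteMeasure (γ.withDensity fun t ↦ ENNReal.ofReal (w t)) := fun w hw ↦ by
    refine isFiniteMeasure_withDensity (ne_top_of_le_ne_top ENNReal.one_ne_top ?_)
    calc ∫⁻ t, ENNReal.ofReal (w t) ∂γ ≤ ∫⁻ _, 1 ∂γ := lintegral_mono fun t ↦ by simp [hw t]
      _ = 1 := by simp
  have := hfin u hu1
  have := hfin v hv1
  -- The convolution of `w` at `s` is, up to `e^{s²/2}`, the moment generating function at `s` of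
  -- the finite measure `w γ`. It is finite for every `s`, so it determines that measure.
  have hmgf : ∀ w : ℝ → ℝ, Continuous w → (∀ t, 0 ≤ w t) → ∀ s,
      mgf id (γ.withDensity fun t ↦ ENNReal.ofReal (w t)) s =
        Real.exp (s ^ 2 / 2) * ∫ t, w (s + t) ∂γ := fun w hw hw0 s ↦ by
    rw [← integral_exp_mul_gaussianReal, mgf, integral_withDensity_eq_integral_toReal_smul
      (by fun_prop) (by simp)]
    congr with t
    rw [ENNReal.toReal_ofReal (hw0 t), smul_eq_mul, mul_comm, id]
  have hint : ∀ w : ℝ → ℝ, Continuous w → (∀ t, 0 ≤ w t) → (∀ t, w t ≤ 1) →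
      integrableExpSet id (γ.withDensity fun t ↦ ENNReal.ofReal (w t)) = Set.univ := by
    intro w hw hw0 hw1
    refine Set.eq_univ_of_forall fun s ↦ ?_
    change Integrable _ _
    rw [integrable_withDensity_iff_integrable_smul' (by fun_prop) (by simp)]
    refine Integrable.bdd_mul (c := 1) (integrable_exp_mul_gaussianReal s)
      (by simpa [ENNReal.toReal_ofReal (hw0 _)] using hw.aestronglyMeasurable)
      (.of_forall fun t ↦ ?_)
    rw [ENNReal.toReal_ofReal (hw0 t), Real.norm_of_nonneg (hw0 t)]
    exact hw1 t
  have hme : mgf id (γ.withDensity fun t ↦ ENNReal.ofReal (u t)) =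
      mgf id (γ.withDensity fun t ↦ ENNReal.ofReal (v t)) := by
    ext s
    rw [hmgf u hu hu0, hmgf v hv hv0, h]
  have hmass : (γ.withDensity fun t ↦ ENNReal.ofReal (u t)) Set.univ =
      (γ.withDensity fun t ↦ ENNReal.ofReal (v t)) Set.univ := by
    have := congrFun hme 0
    rw [mgf_zero', mgf_zero'] at this
    exact (measureReal_eq_measureReal_iff).1 this
  have hmeas : (γ.withDensity fun t ↦ ENNReal.ofReal (u t)) =
      (γ.withDensity fun t ↦ ENNReal.ofReal (v t)) := by
    refine Measure.ext_of_complexMGF_id_eq ?_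
    ext z
    refine eqOn_complexMGF_of_mgf' hme ?_ (by simp [hint u hu hu0 hu1])
    rw [← Measure.measure_univ_eq_zero, hmass, Measure.measure_univ_eq_zero]
  -- Equal measures have `γ`-a.e. equal densities. Lebesgue measure is absolutely continuous with
  -- respect to `γ`, and continuity upgrades equality a.e. to equality everywhere.
  have hae : (fun t ↦ ENNReal.ofReal (u t)) =ᵐ[γ] fun t ↦ ENNReal.ofReal (v t) := by
    refine (withDensity_eq_iff (by fun_prop) (by fun_prop) ?_).1 hmeas
    rw [← setLIntegral_univ, ← withDensity_apply _ .univ]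
    exact measure_ne_top _ _
  have hae' : u =ᵐ[volume] v := by
    filter_upwards [(gaussianReal_absolutelyContinuous' 0 one_ne_zero).ae_eq hae] with t ht
    exact (ENNReal.ofReal_eq_ofReal_iff (hu0 t) (hv0 t)).1 ht
  exact (Continuous.ae_eq_iff_eq volume hu hv).1 hae'

/-! ### Tilted Laplace functionals and cancellation of one Gaussian term -/

lemma enorm_expNeg_sub_le (a b : ℝ≥0∞) : ‖expNeg a - expNeg b‖ₑ ≤ (a - b) + (b - a) := by
  by_cases ha : a = ∞ <;> by_cases hb : b = ∞
  · simp [ha, hb]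
  · simp [ha, ENNReal.top_sub hb]
  · simp [hb, ENNReal.top_sub ha]
  · rw [Real.enorm_eq_ofReal_abs]
    refine (ENNReal.ofReal_le_ofReal (abs_expNeg_sub_expNeg_le ha hb)).trans ?_
    rcases le_total a b with h | h
    · rw [abs_sub_comm, ← ENNReal.toReal_sub_of_le h hb, abs_of_nonneg ENNReal.toReal_nonneg,
        ENNReal.ofReal_toReal (ENNReal.sub_ne_top hb)]
      exact le_add_self
    · rw [← ENNReal.toReal_sub_of_le h ha, abs_of_nonneg ENNReal.toReal_nonneg,
        ENNReal.ofReal_toReal (ENNReal.sub_ne_top ha)]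
      exact le_self_add

/-- Changing `s` to `t` changes the integral by a factor between `e^{-c|t-s|}` and `e^{c|t-s|}`.
This squeezes it also when the integral is infinite. -/
lemma continuous_lintegral_mul_exp {X : Type*} [MeasurableSpace X] (μ : Measure X)
    (g : X → ℝ≥0∞) {h : X → ℝ} {c : ℝ} (hc : ∀ x, |h x| ≤ c) :
    Continuous fun t : ℝ ↦ ∫⁻ x, g x * ENNReal.ofReal (Real.exp (t * h x)) ∂μ := by
  set I : ℝ → ℝ≥0∞ := fun t ↦ ∫⁻ x, g x * ENNReal.ofReal (Real.exp (t * h x)) ∂μ with hI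
  have key : ∀ s t : ℝ, I t ≤ I s * ENNReal.ofReal (Real.exp (|t - s| * c)) := fun s t ↦ by
    rw [hI, ← lintegral_mul_const' _ _ ENNReal.ofReal_ne_top]
    refine lintegral_mono fun x ↦ ?_
    rw [mul_assoc, ← ENNReal.ofReal_mul (Real.exp_pos _).le, ← Real.exp_add]
    gcongr
    have h1 : (t - s) * h x ≤ |t - s| * c := by
      refine (le_abs_self _).trans ?_
      rw [abs_mul]
      gcongr
      exact hc x
    linarith
  have hexp : ∀ (s : ℝ) (d : ℝ), Tendsto (fun t : ℝ ↦ I s * ENNReal.ofReal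
      (Real.exp (d * (|t - s| * c)))) (𝓝 s) (𝓝 (I s)) := fun s d ↦ by
    have h1 : Continuous fun t : ℝ ↦ ENNReal.ofReal (Real.exp (d * (|t - s| * c))) :=
      ENNReal.continuous_ofReal.comp (by fun_prop)
    have h2 := h1.tendsto s
    simp only [sub_self, abs_zero, zero_mul, mul_zero, Real.exp_zero, ENNReal.ofReal_one] at h2
    simpa using ENNReal.Tendsto.const_mul (a := I s) h2 (Or.inl one_ne_zero)
  refine continuous_iff_continuousAt.2 fun s ↦ ?_
  refine tendsto_of_tendsto_of_tendsto_of_le_of_le (hexp s (-1)) (hexp s 1) (fun t ↦ ?_)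
    fun t ↦ by simpa using key s t
  calc I s * ENNReal.ofReal (Real.exp (-1 * (|t - s| * c)))
      ≤ I t * ENNReal.ofReal (Real.exp (|s - t| * c)) *
          ENNReal.ofReal (Real.exp (-1 * (|t - s| * c))) := by gcongr; exact key t s
    _ = I t := by
      rw [mul_assoc, ← ENNReal.ofReal_mul (Real.exp_pos _).le, ← Real.exp_add, abs_sub_comm]
      simp

section

variable {X E Ω : Type*} [mX : MeasurableSpace X] [mE : MeasurableSpace E]
  [mΩ : MeasurableSpace Ω]

/-- The Laplace functional at `f` of the random measure `e ^ Ψ κ`, where `Ψ` and `κ` are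
independent, with laws given by `P` and `Q`. -/
noncomputable def tiltedLaplace (Ψ : X → Ω → ℝ) (P : Measure Ω) (κ : Kernel E X) (Q : Measure E)
    (f : X → ℝ≥0∞) : ℝ :=
  ∫ p : E × Ω, expNeg (∫⁻ x, f x * ENNReal.ofReal (Real.exp (Ψ x p.2)) ∂κ p.1) ∂(Q.prod P)

lemma tiltedLaplace_nonneg (Ψ : X → Ω → ℝ) (P : Measure Ω) (κ : Kernel E X) (Q : Measure E)
    (f : X → ℝ≥0∞) : 0 ≤ tiltedLaplace Ψ P κ Q f :=
  integral_nonneg fun _ ↦ expNeg_nonneg _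

lemma tiltedLaplace_le_one (Ψ : X → Ω → ℝ) (P : Measure Ω) [IsProbabilityMeasure P] (κ : Kernel E X)
    (Q : Measure E) [IsProbabilityMeasure Q] (f : X → ℝ≥0∞) :
    tiltedLaplace Ψ P κ Q f ≤ 1 := by
  have := integral_mono_of_nonneg (μ := Q.prod P)
    (f := fun p ↦ expNeg (∫⁻ x, f x * ENNReal.ofReal (Real.exp (Ψ x p.2)) ∂κ p.1))
    (g := fun _ ↦ 1) (.of_forall fun _ ↦ expNeg_nonneg _) (integrable_const _)
    (.of_forall fun _ ↦ expNeg_le_one _)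
  simpa [tiltedLaplace] using this

lemma measurable_lintegral_mul_exp {Ψ : X → Ω → ℝ}
    (hΨ : Measurable (fun p : X × Ω ↦ Ψ p.1 p.2)) (κ : Kernel E X) [IsSFiniteKernel κ]
    {f : X → ℝ≥0∞} (hf : Measurable f) :
    Measurable fun p : E × Ω ↦ ∫⁻ x, f x * ENNReal.ofReal (Real.exp (Ψ x p.2)) ∂κ p.1 := by
  have h1 : Measurable fun q : (E × Ω) × X ↦ Ψ q.2 q.1.2 :=
    hΨ.comp₂ measurable_snd (measurable_snd.comp measurable_fst)
  exact Measurable.lintegral_kernel_prod_right' (κ := κ.comap Prod.fst measurable_fst)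
    (f := fun q : (E × Ω) × X ↦ f q.2 * ENNReal.ofReal (Real.exp (Ψ q.2 q.1.2))) (by fun_prop)

variable {P : Measure Ω} [IsProbabilityMeasure P] {Q : Measure E} [IsProbabilityMeasure Q]
  {κ : Kernel E X} [IsSFiniteKernel κ]

lemma tiltedLaplace_eq_integral_integral {Ψ : X → Ω → ℝ}
    (hΨ : Measurable (fun p : X × Ω ↦ Ψ p.1 p.2)) {f : X → ℝ≥0∞} (hf : Measurable f) :
    tiltedLaplace Ψ P κ Q f =
      ∫ e, ∫ ω, expNeg (∫⁻ x, f x * ENNReal.ofReal (Real.exp (Ψ x ω)) ∂κ e) ∂P ∂Q := by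
  refine integral_prod _ (Integrable.of_bound (C := 1) ?_ (.of_forall fun p ↦ norm_expNeg_le_one _))
  exact (measurable_expNeg.comp (measurable_lintegral_mul_exp hΨ κ hf)).aestronglyMeasurable

lemma continuous_tiltedLaplace {Ψ : X → Ω → ℝ} (hΨ : Measurable (fun p : X × Ω ↦ Ψ p.1 p.2))
    {f : X → ℝ≥0∞} (hf : Measurable f) {h : X → ℝ} (hh : Measurable h) {c : ℝ}
    (hc : ∀ x, |h x| ≤ c) :
    Continuous fun t : ℝ ↦
      tiltedLaplace Ψ P κ Q (fun x ↦ f x * ENNReal.ofReal (Real.exp (t * h x))) := by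
  refine continuous_of_dominated (bound := fun _ ↦ 1) (fun t ↦ ?_)
    (fun t ↦ .of_forall fun p ↦ norm_expNeg_le_one _) (integrable_const _)
    (.of_forall fun p ↦ continuous_expNeg.comp ?_)
  · exact (measurable_expNeg.comp
      (measurable_lintegral_mul_exp hΨ κ (by fun_prop))).aestronglyMeasurable
  · simp_rw [mul_right_comm (f _)]
    exact continuous_lintegral_mul_exp _ _ hc

variable {Ω' : Type*} [MeasurableSpace Ω'] {P' : Measure Ω'} [IsProbabilityMeasure P']

lemma tiltedLaplace_eq_of_sameFDD [∀ e, IsFiniteMeasure (κ e)] {Ψ : X → Ω → ℝ} {R : X → Ω' → ℝ}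
    (h : SameFDD Ψ R P P') (hΨ : Measurable (fun p : X × Ω ↦ Ψ p.1 p.2))
    (hR : Measurable (fun p : X × Ω' ↦ R p.1 p.2)) {f : X → ℝ≥0∞} (hf : Measurable f) :
    tiltedLaplace Ψ P κ Q f = tiltedLaplace R P' κ Q f := by
  rw [tiltedLaplace_eq_integral_integral hΨ hf, tiltedLaplace_eq_integral_integral hR hf]
  congr with e
  exact h.integral_expNeg_eq hΨ hR
    (F := fun x y ↦ f x * ENNReal.ofReal (Real.exp y)) (by fun_prop) (κ e)

/-- By Fubini the scalar Gaussian variable is integrated last; with its value `t` fixed, the factor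
`e^{t h}` is absorbed into the test function. -/
lemma tiltedLaplace_prod_add {R : X → Ω → ℝ} (hR : Measurable (fun p : X × Ω ↦ R p.1 p.2))
    {h : X → ℝ} (hh : Measurable h) {f : X → ℝ≥0∞} (hf : Measurable f) :
    tiltedLaplace (fun x (p : ℝ × Ω) ↦ p.1 * h x + R x p.2) ((gaussianReal 0 1).prod P) κ Q f =
      ∫ t, tiltedLaplace R P κ Q (fun x ↦ f x * ENNReal.ofReal (Real.exp (t * h x)))
        ∂(gaussianReal 0 1) := by
  have hΨ : Measurable (fun p : X × (ℝ × Ω) ↦ p.2.1 * h p.1 + R p.1 p.2.2) := by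
    have : Measurable (fun p : X × (ℝ × Ω) ↦ R p.1 p.2.2) :=
      hR.comp₂ measurable_fst (measurable_snd.comp measurable_snd)
    fun_prop
  have hm := (measurable_expNeg.comp (measurable_lintegral_mul_exp
    (Ψ := fun x (p : ℝ × Ω) ↦ p.1 * h x + R x p.2) hΨ κ hf))
  have hb : ∀ {α : Type _} [MeasurableSpace α] (ν : Measure α) [IsFiniteMeasure ν]
      {G : α → ℝ≥0∞}, Measurable (fun a ↦ expNeg (G a)) → Integrable (fun a ↦ expNeg (G a)) ν :=
    fun ν _ G hG ↦ Integrable.of_bound (C := 1) hG.aestronglyMeasurable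
      (.of_forall fun p ↦ norm_expNeg_le_one _)
  have e1 : ∀ t (p : E × Ω), ∫⁻ x, f x * ENNReal.ofReal (Real.exp (t * h x + R x p.2)) ∂κ p.1 =
      ∫⁻ x, f x * ENNReal.ofReal (Real.exp (t * h x)) * ENNReal.ofReal (Real.exp (R x p.2))
        ∂κ p.1 := fun t p ↦ by
    congr with x
    rw [mul_assoc, ← ENNReal.ofReal_mul (Real.exp_pos _).le, ← Real.exp_add]
  have hassoc : Measurable fun q : ℝ × (E × Ω) ↦ (q.2.1, (q.1, q.2.2)) := by fun_prop
  have hmap : ((gaussianReal 0 1).prod (Q.prod P)).map (fun q ↦ (q.2.1, (q.1, q.2.2))) =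
      Q.prod ((gaussianReal 0 1).prod P) := by
    have := Measure.isProbabilityMeasure_map (μ := (gaussianReal 0 1).prod (Q.prod P))
      hassoc.aemeasurable
    refine Measure.ext_prod₃ fun {s t u} hs ht hu ↦ ?_
    rw [Measure.map_apply hassoc (hs.prod (ht.prod hu)), Measure.prod_prod, Measure.prod_prod]
    have : (fun q : ℝ × (E × Ω) ↦ (q.2.1, (q.1, q.2.2))) ⁻¹' (s ×ˢ (t ×ˢ u)) =
        t ×ˢ (s ×ˢ u) := by
      ext q; simp; tauto
    rw [this, Measure.prod_prod, Measure.prod_prod]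
    ring
  have e2 := integral_map (μ := (gaussianReal 0 1).prod (Q.prod P)) hassoc.aemeasurable
    (f := fun p : E × (ℝ × Ω) ↦ expNeg (∫⁻ x, f x * ENNReal.ofReal
      (Real.exp (p.2.1 * h x + R x p.2.2)) ∂κ p.1)) hm.aestronglyMeasurable
  rw [tiltedLaplace, ← hmap, e2,
    integral_prod _ (hb _ (hm.comp hassoc))]
  simp_rw [e1]
  rfl

/-- If the laws of two random measures are not distinguished by tilting with a Gaussian field of
covariance `h ⊗ h + C`, then they are not distinguished by tilting with one of covariance `C`. -/
theorem tiltedLaplace_eq_of_split {E' : Type*} [MeasurableSpace E'] {Q' : Measure E'}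
    [IsProbabilityMeasure Q'] {κ' : Kernel E' X} [IsSFiniteKernel κ']
    [∀ e, IsFiniteMeasure (κ e)] [∀ e, IsFiniteMeasure (κ' e)]
    {Ψ : X → Ω → ℝ} {R : X → Ω' → ℝ} {C : X → X → ℝ} {h : X → ℝ}
    (hΨ : Measurable (fun p : X × Ω ↦ Ψ p.1 p.2)) (hR : Measurable (fun p : X × Ω' ↦ R p.1 p.2))
    (hh : Measurable h) (hb : ∃ c, ∀ x, |h x| ≤ c)
    (hΨC : IsCenteredGaussianField Ψ P (fun x y ↦ h x * h y + C x y))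
    (hRC : IsCenteredGaussianField R P' C)
    (heq : ∀ f : X → ℝ≥0∞, Measurable f →
      tiltedLaplace Ψ P κ Q f = tiltedLaplace Ψ P κ' Q' f)
    {f : X → ℝ≥0∞} (hf : Measurable f) :
    tiltedLaplace R P' κ Q f = tiltedLaplace R P' κ' Q' f := by
  obtain ⟨c, hc⟩ := hb
  have hS : Measurable (fun p : X × (ℝ × Ω') ↦ p.2.1 * h p.1 + R p.1 p.2.2) := by
    have : Measurable (fun p : X × (ℝ × Ω') ↦ R p.1 p.2.2) :=
      hR.comp₂ measurable_fst (measurable_snd.comp measurable_snd)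
    fun_prop
  -- `Ψ` has the finite-dimensional distributions of `ξ h + R` with `ξ` standard Gaussian
  -- independent of `R`.
  have hfdd := hΨC.sameFDD (hRC.prod_add h)
    (fun x ↦ hΨ.comp₂ measurable_const measurable_id)
    (fun x ↦ hS.comp₂ (F := fun x (p : ℝ × Ω') ↦ p.1 * h x + R x p.2)
      measurable_const measurable_id)
  have := eq_of_gaussian_convolution_eq
    (continuous_tiltedLaplace (P := P') (κ := κ) (Q := Q) hR hf hh hc)
    (continuous_tiltedLaplace (P := P') (κ := κ') (Q := Q') hR hf hh hc)
    (fun _ ↦ tiltedLaplace_nonneg _ _ _ _ _) (fun _ ↦ tiltedLaplace_nonneg _ _ _ _ _)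
    (fun _ ↦ tiltedLaplace_le_one _ _ _ _ _) (fun _ ↦ tiltedLaplace_le_one _ _ _ _ _) fun s ↦ ?_
  -- The two functions of the shift agree everywhere; at shift `0` the test function is `f` itself.
  · simpa using congrFun this 0
  have e1 : ∀ t, (fun x ↦ f x * ENNReal.ofReal (Real.exp ((s + t) * h x))) = fun x ↦
      (f x * ENNReal.ofReal (Real.exp (s * h x))) * ENNReal.ofReal (Real.exp (t * h x)) :=
    fun t ↦ by
      ext x
      rw [mul_assoc, ← ENNReal.ofReal_mul (Real.exp_pos _).le, ← Real.exp_add, add_mul]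
  have hfs : Measurable fun x ↦ f x * ENNReal.ofReal (Real.exp (s * h x)) := by fun_prop
  simp_rw [e1]
  rw [← tiltedLaplace_prod_add hR hh hfs, ← tiltedLaplace_prod_add hR hh hfs,
    ← tiltedLaplace_eq_of_sameFDD hfdd hΨ hS hfs, ← tiltedLaplace_eq_of_sameFDD hfdd hΨ hS hfs]
  exact heq _ hfs

end

/-! ### Vanishing of the tilt as the variance tends to zero -/

/-- The mean deviation from `1` of the exponential of a centered Gaussian with variance `v`. -/
noncomputable def expDev (v : ℝ) : ℝ≥0∞ :=
  ∫⁻ y, ENNReal.ofReal |Real.exp (√v * y) - 1| ∂(gaussianReal 0 1)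

lemma lintegral_exp_sub_one_gaussianReal {v : ℝ} (hv : 0 ≤ v) :
    ∫⁻ y, ENNReal.ofReal |Real.exp y - 1| ∂(gaussianReal 0 v.toNNReal) = expDev v := by
  have : gaussianReal 0 v.toNNReal = (gaussianReal 0 1).map (√v * ·) := by
    rw [gaussianReal_map_const_mul, mul_zero, mul_one]
    congr 1
    ext
    simp [Real.sq_sqrt hv, hv]
  rw [this, lintegral_map (by fun_prop) (by fun_prop), expDev]

lemma abs_exp_sub_one_le (s y m : ℝ) (hs : 0 ≤ s) (hm : s ≤ m) :
    |Real.exp (s * y) - 1| ≤ Real.exp (m * y) + Real.exp (-m * y) := by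
  have h1 : Real.exp (s * y) ≤ Real.exp (m * y) + Real.exp (-m * y) := by
    rcases le_total 0 y with hy | hy
    · have : Real.exp (s * y) ≤ Real.exp (m * y) := Real.exp_le_exp.2 (by gcongr)
      linarith [Real.exp_pos (-m * y)]
    · have : Real.exp (s * y) ≤ Real.exp (-m * y) := Real.exp_le_exp.2 (by nlinarith)
      linarith [Real.exp_pos (m * y)]
  have h2 : 1 ≤ Real.exp (m * y) + Real.exp (-m * y) := by
    rcases le_total 0 (m * y) with hy | hy
    · linarith [Real.one_le_exp hy, Real.exp_pos (-m * y)]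
    · linarith [Real.one_le_exp (by linarith : 0 ≤ -m * y), Real.exp_pos (m * y)]
  rw [abs_le]
  constructor <;> linarith [Real.exp_pos (s * y)]

lemma lintegral_exp_add_exp_ne_top (m : ℝ) :
    ∫⁻ y, ENNReal.ofReal (Real.exp (m * y) + Real.exp (-m * y)) ∂(gaussianReal 0 1) ≠ ∞ :=
  ((integrable_exp_mul_gaussianReal m).add (integrable_exp_mul_gaussianReal (-m))).lintegral_lt_top.ne

lemma exists_expDev_le (m : ℝ) : ∃ K ≠ ∞, ∀ v ≤ m, expDev v ≤ K :=
  ⟨_, lintegral_exp_add_exp_ne_top √m, fun v hv ↦ lintegral_mono fun _ ↦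
    ENNReal.ofReal_le_ofReal (abs_exp_sub_one_le _ _ _ (Real.sqrt_nonneg v) (Real.sqrt_le_sqrt hv))⟩

lemma tendsto_expDev {v : ℕ → ℝ} (hv : Tendsto v atTop (𝓝 0)) :
    Tendsto (fun n ↦ expDev (v n)) atTop (𝓝 0) := by
  have h0 : ∫⁻ _ : ℝ, (0 : ℝ≥0∞) ∂(gaussianReal 0 1) = 0 := by simp
  rw [← h0]
  refine tendsto_lintegral_filter_of_dominated_convergence _
    (.of_forall fun n ↦ by fun_prop) ?_ (lintegral_exp_add_exp_ne_top 1) (.of_forall fun y ↦ ?_)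
  · filter_upwards [hv.eventually_le_const one_pos] with n hn
    refine .of_forall fun y ↦ ENNReal.ofReal_le_ofReal
      (abs_exp_sub_one_le _ _ _ (Real.sqrt_nonneg _) ?_)
    simpa using hn
  · have h1 : Continuous fun v : ℝ ↦ ENNReal.ofReal |Real.exp (√v * y) - 1| :=
      ENNReal.continuous_ofReal.comp (by fun_prop)
    simpa [Function.comp_def] using (h1.tendsto 0).comp hv

section

variable {X Ω : Type*} [mX : MeasurableSpace X] [mΩ : MeasurableSpace Ω]

/-- `expNeg` is 1-Lipschitz in the sense of `enorm_expNeg_sub_le`. Of the truncated differences `f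
e^r - f` and `f - f e^r`, one vanishes at each point and the other is at most `f |e^r - 1|`. -/
lemma enorm_expNeg_lintegral_sub_le (μ : Measure X) {f : X → ℝ≥0∞} (hf : Measurable f)
    {r : X → ℝ} (hr : Measurable r) :
    ‖expNeg (∫⁻ x, f x * ENNReal.ofReal (Real.exp (r x)) ∂μ) - expNeg (∫⁻ x, f x ∂μ)‖ₑ ≤
      ∫⁻ x, f x * ENNReal.ofReal |Real.exp (r x) - 1| ∂μ := by
  have hle : ∀ x, f x * ENNReal.ofReal (Real.exp (r x)) - f x +
      (f x - f x * ENNReal.ofReal (Real.exp (r x))) ≤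
      f x * ENNReal.ofReal |Real.exp (r x) - 1| := fun x ↦ by
    rcases le_total 1 (Real.exp (r x)) with h | h
    · have h1 : f x ≤ f x * ENNReal.ofReal (Real.exp (r x)) :=
        le_mul_of_one_le_right' (by simpa using h)
      rw [tsub_eq_zero_of_le h1, add_zero, abs_of_nonneg (by linarith), tsub_le_iff_right]
      nth_rw 3 [← mul_one (f x)]
      rw [← mul_add, ← ENNReal.ofReal_one, ← ENNReal.ofReal_add (by linarith) zero_le_one,
        sub_add_cancel]
    · have h1 : f x * ENNReal.ofReal (Real.exp (r x)) ≤ f x :=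
        mul_le_of_le_one_right' (by simpa using h)
      rw [tsub_eq_zero_of_le h1, zero_add, abs_sub_comm, abs_of_nonneg (by linarith),
        tsub_le_iff_right, ← mul_add, ← ENNReal.ofReal_add (by linarith) (Real.exp_pos _).le,
        sub_add_cancel, ENNReal.ofReal_one, mul_one]
  refine (enorm_expNeg_sub_le _ _).trans ?_
  calc _ ≤ ∫⁻ x, (f x * ENNReal.ofReal (Real.exp (r x)) - f x) ∂μ +
        ∫⁻ x, (f x - f x * ENNReal.ofReal (Real.exp (r x))) ∂μ :=
        add_le_add (lintegral_sub_le' _ _ hf.aemeasurable) (lintegral_sub_le' _ _ (by fun_prop))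
    _ = ∫⁻ x, (f x * ENNReal.ofReal (Real.exp (r x)) - f x +
        (f x - f x * ENNReal.ofReal (Real.exp (r x)))) ∂μ :=
        (lintegral_add_left (by fun_prop) _).symm
    _ ≤ _ := lintegral_mono hle

variable {P : Measure Ω} [IsProbabilityMeasure P]

/-- Gaussian fields whose pointwise variances are bounded and tend to zero do not perturb the
Laplace functional of a finite measure in the limit. -/
theorem tendsto_integral_expNeg_of_variance_tendsto_zero (μ : Measure X) [IsFiniteMeasure μ]
    {f : X → ℝ≥0∞} (hf : Measurable f) {B : ℝ≥0∞} (hB : B ≠ ∞) (hfB : ∀ x, f x ≤ B)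
    {R : ℕ → X → Ω → ℝ} (hR : ∀ n, Measurable (fun p : X × Ω ↦ R n p.1 p.2))
    {C : ℕ → X → X → ℝ} (hRC : ∀ n, IsCenteredGaussianField (R n) P (C n))
    (hC : ∀ n x, 0 ≤ C n x x) (hlim : ∀ x, Tendsto (fun n ↦ C n x x) atTop (𝓝 0))
    {m : ℝ} (hm : ∀ n x, f x ≠ 0 → C n x x ≤ m) :
    Tendsto (fun n ↦ ∫ ω, expNeg (∫⁻ x, f x * ENNReal.ofReal (Real.exp (R n x ω)) ∂μ) ∂P) atTop
      (𝓝 (expNeg (∫⁻ x, f x ∂μ))) := by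
  obtain ⟨K, hK, hKm⟩ := exists_expDev_le m
  have hmarg : ∀ n x, ∫⁻ ω, ENNReal.ofReal |Real.exp (R n x ω) - 1| ∂P = expDev (C n x x) := by
    intro n x
    have hRx : Measurable (R n x) := (hR n).comp₂ measurable_const measurable_id
    rw [← lintegral_exp_sub_one_gaussianReal (hC n x),
      ← (hRC n).map_eq_gaussianReal x (hC n x) hRx, lintegral_map (by fun_prop) hRx]
  have hdev : ∀ n, Measurable fun x ↦ expDev (C n x x) := fun n ↦ by
    simp_rw [← hmarg]
    exact Measurable.lintegral_prod_right'
      (f := fun p : X × Ω ↦ ENNReal.ofReal |Real.exp (R n p.1 p.2) - 1|) (by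
        have := hR n
        fun_prop)
  have hint : ∀ n, Measurable fun ω ↦
      expNeg (∫⁻ x, f x * ENNReal.ofReal (Real.exp (R n x ω)) ∂μ) := fun n ↦
    measurable_expNeg.comp (Measurable.lintegral_prod_left'
      (f := fun p : X × Ω ↦ f p.1 * ENNReal.ofReal (Real.exp (R n p.1 p.2))) (by
        have := hR n
        fun_prop))
  -- By Tonelli the error is at most the `μ`-integral of `f` times the mean of `|e^R - 1|`, and this
  -- mean depends only on the variance at the point.
  have hbound : ∀ n, ‖∫ ω, expNeg (∫⁻ x, f x * ENNReal.ofReal (Real.exp (R n x ω)) ∂μ) ∂P -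
      expNeg (∫⁻ x, f x ∂μ)‖ₑ ≤ ∫⁻ x, f x * expDev (C n x x) ∂μ := fun n ↦ by
    have e1 : ∫ ω, expNeg (∫⁻ x, f x * ENNReal.ofReal (Real.exp (R n x ω)) ∂μ) ∂P -
        expNeg (∫⁻ x, f x ∂μ) = ∫ ω, (expNeg (∫⁻ x, f x * ENNReal.ofReal (Real.exp (R n x ω)) ∂μ) -
        expNeg (∫⁻ x, f x ∂μ)) ∂P := by
      rw [integral_sub (Integrable.of_bound (C := 1) (hint n).aestronglyMeasurable
        (.of_forall fun _ ↦ norm_expNeg_le_one _)) (integrable_const _)]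
      simp
    rw [e1]
    refine (enorm_integral_le_lintegral_enorm _).trans ?_
    calc _ ≤ ∫⁻ ω, ∫⁻ x, f x * ENNReal.ofReal |Real.exp (R n x ω) - 1| ∂μ ∂P :=
          lintegral_mono fun ω ↦ enorm_expNeg_lintegral_sub_le μ hf
            ((hR n).comp₂ measurable_id measurable_const)
      _ = ∫⁻ x, ∫⁻ ω, f x * ENNReal.ofReal |Real.exp (R n x ω) - 1| ∂P ∂μ := by
          refine lintegral_lintegral_swap (Measurable.aemeasurable ?_)
          have : Measurable fun p : Ω × X ↦ R n p.2 p.1 :=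
            (hR n).comp₂ measurable_snd measurable_fst
          simp only [Function.uncurry_def]
          fun_prop
      _ = _ := by
          congr with x
          have hRx : Measurable (R n x) := (hR n).comp₂ measurable_const measurable_id
          rw [lintegral_const_mul _ (by fun_prop), hmarg]
  have hzero : Tendsto (fun n ↦ ∫⁻ x, f x * expDev (C n x x) ∂μ) atTop (𝓝 0) := by
    have h0 : ∫⁻ _ : X, (0 : ℝ≥0∞) ∂μ = 0 := by simp
    rw [← h0]
    refine tendsto_lintegral_of_dominated_convergence (fun _ ↦ B * K)
      (fun n ↦ hf.mul (hdev n)) (fun n ↦ .of_forall fun x ↦ ?_) ?_ (.of_forall fun x ↦ ?_)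
    · by_cases hx : f x = 0
      · simp [hx]
      · exact mul_le_mul' (hfB x) (hKm _ (hm n x hx))
    · rw [lintegral_const]
      exact ENNReal.mul_ne_top (ENNReal.mul_ne_top hB hK) (measure_ne_top _ _)
    · simpa using ENNReal.Tendsto.const_mul (tendsto_expDev (hlim x))
        (Or.inr (ne_top_of_le_ne_top hB (hfB x)))
  rw [tendsto_iff_edist_tendsto_0]
  simp_rw [edist_eq_enorm_sub]
  exact tendsto_of_tendsto_of_tendsto_of_le_of_le tendsto_const_nhds hzero (fun _ ↦ zero_le)
    hbound

end

/-! ### The Laplace functional determines the law of a random measure -/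

@[simp] lemma expNeg_zero : expNeg 0 = 1 := by simp [expNeg_of_ne_top]

lemma expNeg_nsmul (n : ℕ) (a : ℝ≥0∞) : expNeg (n * a) = expNeg a ^ n := by
  induction n with
  | zero => simp
  | succ n ih => rw [Nat.cast_succ, add_mul, one_mul, expNeg_add, ih, pow_succ]

lemma expNeg_sum {ι : Type*} (s : Finset ι) (a : ι → ℝ≥0∞) :
    expNeg (∑ i ∈ s, a i) = ∏ i ∈ s, expNeg (a i) := by
  classical
  induction s using Finset.induction_on with
  | empty => simp
  | insert i s hi ih => rw [Finset.sum_insert hi, Finset.prod_insert hi, expNeg_add, ih]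

/-- `expNeg` as a map into the unit interval. -/
noncomputable def expNegI (a : ℝ≥0∞) : unitInterval := ⟨expNeg a, expNeg_nonneg a, expNeg_le_one a⟩

/-- An injective measurable map between standard Borel spaces is an embedding. -/
lemma measurableEmbedding_expNegI : MeasurableEmbedding expNegI := by
  refine Measurable.measurableEmbedding (measurable_expNeg.subtype_mk) fun a b h ↦ ?_
  have : (expNegI a : ℝ) = expNegI b := by rw [h]
  exact expNeg_injective this

/-- Two probability laws on a finite power of the unit interval with the same mixed moments are
equal. -/
lemma ext_of_forall_integral_prod_pow_eq {ι : Type*} [Fintype ι] {μ ν : Measure (ι → unitInterval)}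
    [IsFiniteMeasure μ] [IsFiniteMeasure ν]
    (h : ∀ n : ι → ℕ, ∫ v, ∏ i, (v i : ℝ) ^ n i ∂μ = ∫ v, ∏ i, (v i : ℝ) ^ n i ∂ν) : μ = ν := by
  classical
  let c : ι → BoundedContinuousFunction (ι → unitInterval) ℝ := fun i ↦
    BoundedContinuousFunction.mkOfCompact ⟨fun v ↦ (v i : ℝ), by fun_prop⟩
  let A : StarSubalgebra ℝ (BoundedContinuousFunction (ι → unitInterval) ℝ) :=
    { Algebra.adjoin ℝ (Set.range c) with
      star_mem' := fun {a} ha ↦ by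
        have : star a = a := by ext; simp
        rw [this]; exact ha }
  -- The algebra generated by the coordinates is spanned by monomials and separates points, so its
  -- integrals determine the measure.
  have hmon : ∀ g ∈ Submonoid.closure (Set.range c), ∃ n : ι → ℕ, ∀ v, g v = ∏ i, (v i : ℝ) ^ n i := by
    intro g hg
    induction hg using Submonoid.closure_induction with
    | mem g hg =>
      obtain ⟨i, rfl⟩ := hg
      refine ⟨Pi.single i 1, fun v ↦ ?_⟩
      rw [Finset.prod_eq_single i]
      · simp [c]
      · intro j _ hj
        simp [hj]
      · simp
    | one => exact ⟨0, fun v ↦ by simp⟩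
    | mul g g' _ _ hg hg' =>
      obtain ⟨n, hn⟩ := hg
      obtain ⟨n', hn'⟩ := hg'
      refine ⟨n + n', fun v ↦ ?_⟩
      rw [BoundedContinuousFunction.mul_apply, hn, hn', ← Finset.prod_mul_distrib]
      simp [pow_add]
  refine ext_of_forall_mem_subalgebra_integral_eq_of_polish (𝕜 := ℝ) (A := A) ?_ fun g hg ↦ ?_
  · intro v w hvw
    obtain ⟨i, hi⟩ := Function.ne_iff.1 hvw
    refine ⟨fun v ↦ (v i : ℝ), ⟨BoundedContinuousFunction.toContinuousMap (c i),
      ⟨c i, Algebra.subset_adjoin ⟨i, rfl⟩, rfl⟩, rfl⟩, ?_⟩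
    exact fun h ↦ hi (Subtype.ext h)
  · have hg' : g ∈ Submodule.span ℝ (Submonoid.closure (Set.range c) : Set _) := by
      rw [← Algebra.adjoin_eq_span]
      exact hg
    clear hg
    induction hg' using Submodule.span_induction with
    | mem g hg =>
      obtain ⟨n, hn⟩ := hmon g hg
      simp_rw [hn, h]
    | zero => simp
    | add f g _ _ ihf ihg =>
      have e : ∀ ρ : Measure (ι → unitInterval), IsFiniteMeasure ρ →
          ∫ v, (f + g) v ∂ρ = ∫ v, f v ∂ρ + ∫ v, g v ∂ρ := fun ρ _ ↦
        integral_add (f.integrable ρ) (g.integrable ρ)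
      rw [e μ ‹_›, e ν ‹_›, ihf, ihg]
    | smul r f _ ihf =>
      have e : ∀ ρ : Measure (ι → unitInterval), ∫ v, (r • f) v ∂ρ = r * ∫ v, f v ∂ρ := fun ρ ↦
        integral_const_mul r _
      rw [e, e, ihf]

section

variable {X : Type*} [mX : MeasurableSpace X]

/-- The values `exp (-μ A)` of a measure on measurable sets. -/
noncomputable def evalExpNeg (μ : Measure X) (A : {A : Set X // MeasurableSet A}) : unitInterval :=
  expNegI (μ A)

lemma measurable_evalExpNeg : Measurable (evalExpNeg (X := X)) :=
  measurable_pi_lambda _ fun A ↦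
    measurableEmbedding_expNegI.measurable.comp (Measure.measurable_coe A.2)

/-- The evaluations generate the σ-algebra on measures, and `expNegI` loses no measurable set. So
equality of laws may be checked on the images in the cube. -/
lemma exists_measurableSet_preimage_evalExpNeg {S : Set (Measure X)} (hS : MeasurableSet S) :
    ∃ S', MeasurableSet S' ∧ evalExpNeg ⁻¹' S' = S := by
  have : (Measure.instMeasurableSpace : MeasurableSpace (Measure X)) ≤
      MeasurableSpace.comap evalExpNeg inferInstance := by
    refine iSup_le fun A ↦ iSup_le fun hA ↦ ?_
    rintro _ ⟨B, hB, rfl⟩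
    refine ⟨(fun v ↦ v ⟨A, hA⟩) ⁻¹' (expNegI '' B),
      measurable_pi_apply _ (measurableEmbedding_expNegI.measurableSet_image.2 hB), ?_⟩
    ext μ
    exact measurableEmbedding_expNegI.injective.mem_set_image
  exact this S hS

/-- Mixed moments of the variables `exp (-M A)` are Laplace functionals at simple functions with
integer coefficients. -/
lemma integral_prod_pow_map_evalExpNeg {E : Type*} [MeasurableSpace E] {Q : Measure E}
    {M : E → Measure X} (hM : Measurable M) (J : Finset {A : Set X // MeasurableSet A})
    (n : J → ℕ) :
    ∫ v, ∏ i, (v i : ℝ) ^ n i ∂((Q.map (fun e ↦ evalExpNeg (M e))).map J.restrict) =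
      ∫ e, expNeg (∫⁻ x, ∑ i : J, n i * (i : Set X).indicator 1 x ∂M e) ∂Q := by
  have hT : Measurable (fun e ↦ evalExpNeg (M e)) := measurable_evalExpNeg.comp hM
  rw [Measure.map_map (Finset.measurable_restrict J) hT,
    integral_map ((Finset.measurable_restrict J).comp hT).aemeasurable
      (Continuous.aestronglyMeasurable (by fun_prop))]
  congr with e
  rw [lintegral_finsetSum _ fun i _ ↦ (measurable_one.indicator i.1.2).const_mul _, expNeg_sum]
  refine Finset.prod_congr rfl fun i _ ↦ ?_
  rw [lintegral_const_mul _ (measurable_one.indicator i.1.2), lintegral_indicator_one i.1.2,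
    expNeg_nsmul]
  rfl

/-- The law of a random measure is determined by its Laplace functional. -/
theorem map_eq_map_of_laplace_eq {E E' : Type*} [MeasurableSpace E] [MeasurableSpace E']
    {Q : Measure E} {Q' : Measure E'} [IsProbabilityMeasure Q] [IsProbabilityMeasure Q']
    {M : E → Measure X} {M' : E' → Measure X} (hM : Measurable M) (hM' : Measurable M')
    (h : ∀ f : X → ℝ≥0∞, Measurable f → (∃ B ≠ ∞, ∀ x, f x ≤ B) →
      ∫ e, expNeg (∫⁻ x, f x ∂M e) ∂Q = ∫ e, expNeg (∫⁻ x, f x ∂M' e) ∂Q') :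
    Q.map M = Q'.map M' := by
  have hT := measurable_evalExpNeg (X := X)
  suffices Q.map (fun e ↦ evalExpNeg (M e)) = Q'.map (fun e ↦ evalExpNeg (M' e)) by
    ext S hS
    obtain ⟨S', hS', rfl⟩ := exists_measurableSet_preimage_evalExpNeg hS
    rw [← Measure.map_apply hT hS', ← Measure.map_apply hT hS', Measure.map_map hT hM,
      Measure.map_map hT hM']
    exact congrArg (· S') this
  have := Measure.isProbabilityMeasure_map (μ := Q) (hT.comp hM).aemeasurable
  have := Measure.isProbabilityMeasure_map (μ := Q') (hT.comp hM').aemeasurable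
  -- The cube has one coordinate per measurable set; a finite measure on it is determined by its
  -- finite-dimensional marginals.
  refine IsProjectiveLimit.unique (P := fun J ↦ (Q'.map (fun e ↦ evalExpNeg (M' e))).map J.restrict)
    (fun J ↦ ?_) (fun J ↦ rfl)
  refine ext_of_forall_integral_prod_pow_eq fun n ↦ ?_
  refine (integral_prod_pow_map_evalExpNeg hM J n).trans (Eq.trans ?_
    (integral_prod_pow_map_evalExpNeg hM' J n).symm)
  refine h _ (Finset.measurable_fun_sum _ fun i _ ↦ (measurable_one.indicator i.1.2).const_mul _)
    ⟨∑ i : J, (n i : ℝ≥0∞), by simp, fun x ↦ ?_⟩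
  refine Finset.sum_le_sum fun i _ ↦ mul_le_of_le_one_right' ?_
  exact Set.indicator_le_self' (fun _ _ ↦ zero_le) x

end

/-! ### Finite measures as an s-finite kernel -/

section

variable {X : Type*} [mX : MeasurableSpace X]

lemma measurableSet_natFloor_mass (n : ℕ) :
    MeasurableSet {μ : Measure X | (n : ℝ≥0∞) ≤ μ Set.univ ∧ μ Set.univ < n + 1} :=
  (measurableSet_le measurable_const (Measure.measurable_coe .univ)).inter
    (measurableSet_lt (Measure.measurable_coe .univ) measurable_const)

open Classical in
/-- The kernel `μ ↦ μ` on measures with mass in `[n, n + 1)`, zero on the other ones. -/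
noncomputable def massKernel (X : Type*) [MeasurableSpace X] (n : ℕ) : Kernel (Measure X) X :=
  Kernel.piecewise (measurableSet_natFloor_mass n) ⟨id, measurable_id⟩ 0

lemma massKernel_apply (n : ℕ) (μ : Measure X) [Decidable ((n : ℝ≥0∞) ≤ μ Set.univ ∧
    μ Set.univ < n + 1)] : massKernel X n μ =
      if (n : ℝ≥0∞) ≤ μ Set.univ ∧ μ Set.univ < n + 1 then μ else 0 := by
  rw [massKernel, Kernel.piecewise_apply]
  simp only [Set.mem_ofPred_eq]
  congr

instance (n : ℕ) : IsFiniteKernel (massKernel X n) := by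
  classical
  refine ⟨n + 1, by simp, fun μ ↦ ?_⟩
  rw [massKernel_apply]
  split_ifs with h
  · exact h.2.le
  · simp

/-- The s-finite kernel `μ ↦ μ` on finite measures, zero on infinite ones. -/
noncomputable def finiteMeasureKernel (X : Type*) [MeasurableSpace X] : Kernel (Measure X) X :=
  Kernel.sum (massKernel X)

/-- S-finiteness makes the tilted integral jointly measurable in the measure and the field. An
arbitrary measure need not be s-finite, hence the slicing by mass and the value zero at infinite
measures. -/
instance : IsSFiniteKernel (finiteMeasureKernel X) :=
  inferInstanceAs (IsSFiniteKernel (Kernel.sum (massKernel X)))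

lemma finiteMeasureKernel_apply (μ : Measure X) [IsFiniteMeasure μ] :
    finiteMeasureKernel X μ = μ := by
  classical
  have hfin := measure_ne_top μ Set.univ
  have key : ∀ n : ℕ, ((n : ℝ≥0∞) ≤ μ Set.univ ∧ μ Set.univ < n + 1) ↔
      ⌊(μ Set.univ).toReal⌋₊ = n := fun n ↦ by
    rw [Nat.floor_eq_iff ENNReal.toReal_nonneg, ← ENNReal.toReal_le_toReal (by simp) hfin,
      ← ENNReal.toReal_lt_toReal hfin (by simp), ENNReal.toReal_natCast]
    simp [ENNReal.toReal_add]
  ext s hs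
  rw [finiteMeasureKernel, Kernel.sum_apply, Measure.sum_apply _ hs,
    tsum_eq_single ⌊(μ Set.univ).toReal⌋₊]
  · rw [massKernel_apply, if_pos ((key _).2 rfl)]
  · intro n hn
    rw [massKernel_apply, if_neg fun h ↦ hn ((key n).1 h).symm]
    simp

instance (μ : Measure X) : IsFiniteMeasure (finiteMeasureKernel X μ) := by
  classical
  by_cases h : μ Set.univ = ∞
  · have : finiteMeasureKernel X μ = 0 := by
      ext s hs
      rw [finiteMeasureKernel, Kernel.sum_apply, Measure.sum_apply _ hs]
      simp [massKernel_apply, h]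
    rw [this]
    infer_instance
  · have : IsFiniteMeasure μ := ⟨lt_top_iff_ne_top.2 h⟩
    rwa [finiteMeasureKernel_apply]

/-! ### Cancellation of the whole Gaussian series -/

lemma measurable_expNeg_lintegral {E : Type*} [MeasurableSpace E] {f : X → ℝ≥0∞} (hf : Measurable f) (κ : Kernel E X) :
    Measurable fun e ↦ expNeg (∫⁻ x, f x ∂κ e) :=
  measurable_expNeg.comp ((Measure.measurable_lintegral hf).comp κ.measurable)

lemma tendsto_integral_expNeg_indicator {E : Type*} [MeasurableSpace E] {Q : Measure E}
    [IsFiniteMeasure Q] {κ : Kernel E X} {V : X → ℝ} (hV : Measurable V)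
    {f : X → ℝ≥0∞} (hf : Measurable f) :
    Tendsto (fun m : ℕ ↦ ∫ e, expNeg (∫⁻ x, {x | V x ≤ m}.indicator f x ∂κ e) ∂Q) atTop
      (𝓝 (∫ e, expNeg (∫⁻ x, f x ∂κ e) ∂Q)) := by
  have hA : ∀ m : ℕ, MeasurableSet {x | V x ≤ m} := fun m ↦ measurableSet_le hV measurable_const
  refine tendsto_integral_of_dominated_convergence (fun _ ↦ 1)
    (fun m ↦ (measurable_expNeg_lintegral (hf.indicator (hA m)) κ).aestronglyMeasurable)
    (integrable_const _) (fun m ↦ .of_forall fun _ ↦ norm_expNeg_le_one _)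
    (.of_forall fun e ↦ (continuous_expNeg.tendsto _).comp ?_)
  refine lintegral_tendsto_of_tendsto_of_monotone (fun m ↦ (hf.indicator (hA m)).aemeasurable)
    (.of_forall fun x m n hmn ↦ Set.indicator_le_indicator_of_subset (fun y hy ↦ ?_)
      (fun _ ↦ zero_le) x) (.of_forall fun x ↦ ?_)
  · have h1 : V y ≤ m := hy
    have h2 : (m : ℝ) ≤ n := by exact_mod_cast hmn
    exact h1.trans h2
  · refine tendsto_const_nhds.congr' ?_
    filter_upwards [eventually_ge_atTop ⌈V x⌉₊] with m hm
    rw [Set.indicator_of_mem]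
    have h1 : (⌈V x⌉₊ : ℝ) ≤ m := by exact_mod_cast hm
    exact (Nat.le_ceil (V x)).trans h1

variable {E E' : Type*} [MeasurableSpace E] [MeasurableSpace E'] {Q : Measure E} {Q' : Measure E'}
  [IsProbabilityMeasure Q] [IsProbabilityMeasure Q'] {κ : Kernel E X} {κ' : Kernel E' X}
  [IsSFiniteKernel κ] [IsSFiniteKernel κ'] [∀ e, IsFiniteMeasure (κ e)]
  [∀ e, IsFiniteMeasure (κ' e)]

/-- Induction on the number of cancelled terms: the covariance of the series from index `n` on is `h
n ⊗ h n` plus that of the series from `n + 1` on. The test function varies in the induction because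
each cancellation uses all of them. -/
lemma tiltedLaplace_gaussianSeries_shift {h : ℕ → X → ℝ} (hh : ∀ k, Measurable (h k))
    (hb : ∀ k, ∃ c, ∀ x, |h k x| ≤ c) (hs : ∀ x, Summable fun k ↦ h k x ^ 2)
    (heq : ∀ f : X → ℝ≥0∞, Measurable f → tiltedLaplace (gaussianSeries h) gaussianSeq κ Q f =
      tiltedLaplace (gaussianSeries h) gaussianSeq κ' Q' f) (n : ℕ) {f : X → ℝ≥0∞}
    (hf : Measurable f) :
    tiltedLaplace (gaussianSeries fun k ↦ h (k + n)) gaussianSeq κ Q f =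
      tiltedLaplace (gaussianSeries fun k ↦ h (k + n)) gaussianSeq κ' Q' f := by
  induction n generalizing f with
  | zero => exact heq f hf
  | succ n ih =>
    have hs' : ∀ n x, Summable fun k ↦ h (k + n) x ^ 2 := fun n x ↦
      (summable_nat_add_iff (f := fun k ↦ h k x ^ 2) n).2 (hs x)
    refine tiltedLaplace_eq_of_split (Ψ := gaussianSeries fun k ↦ h (k + n)) (P := gaussianSeq)
      (C := fun x y ↦ ∑' k, h (k + (n + 1)) x * h (k + (n + 1)) y)
      (measurable_gaussianSeries fun k ↦ hh _) (measurable_gaussianSeries fun k ↦ hh _) (hh n) (hb n)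
      ?_ (isCenteredGaussianField_gaussianSeries fun x ↦ hs' (n + 1) x) (fun f hf ↦ ih hf) hf
    convert isCenteredGaussianField_gaussianSeries fun x ↦ hs' n x using 3 with x y
    rw [(summable_mul_of_summable_sq (hs' n x) (hs' n y)).tsum_eq_zero_add]
    simp [add_assoc, add_comm 1]

lemma tendsto_tiltedLaplace_gaussianSeries_shift {h : ℕ → X → ℝ} (hh : ∀ k, Measurable (h k))
    (hs : ∀ x, Summable fun k ↦ h k x ^ 2) {f : X → ℝ≥0∞} (hf : Measurable f)
    {B : ℝ≥0∞} (hB : B ≠ ∞) (hfB : ∀ x, f x ≤ B) {m : ℝ}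
    (hm : ∀ x, f x ≠ 0 → ∑' k, h k x ^ 2 ≤ m) :
    Tendsto (fun n ↦ tiltedLaplace (gaussianSeries fun k ↦ h (k + n)) gaussianSeq κ Q f) atTop
      (𝓝 (∫ e, expNeg (∫⁻ x, f x ∂κ e) ∂Q)) := by
  have hs' : ∀ n x, Summable fun k ↦ h (k + n) x ^ 2 := fun n x ↦
    (summable_nat_add_iff (f := fun k ↦ h k x ^ 2) n).2 (hs x)
  have hR : ∀ n, Measurable (fun p : X × (ℕ → ℝ) ↦ gaussianSeries (fun k ↦ h (k + n)) p.1 p.2) :=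
    fun n ↦ measurable_gaussianSeries fun k ↦ hh _
  simp_rw [fun n ↦ tiltedLaplace_eq_integral_integral (P := gaussianSeq) (Q := Q) (κ := κ)
    (hR n) hf]
  refine tendsto_integral_of_dominated_convergence (fun _ ↦ 1) (fun n ↦ ?_)
    (integrable_const _) (fun n ↦ .of_forall fun e ↦ ?_) (.of_forall fun e ↦ ?_)
  · exact ((measurable_expNeg.comp (measurable_lintegral_mul_exp (hR n) κ
      hf)).stronglyMeasurable.integral_prod_right').aestronglyMeasurable
  · simpa using norm_integral_le_of_norm_le_const (μ := gaussianSeq) (C := 1)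
      (.of_forall fun ω ↦ norm_expNeg_le_one (∫⁻ x, f x * ENNReal.ofReal
        (Real.exp (gaussianSeries (fun k ↦ h (k + n)) x ω)) ∂κ e))
  · refine tendsto_integral_expNeg_of_variance_tendsto_zero (κ e) hf hB hfB hR
      (fun n ↦ isCenteredGaussianField_gaussianSeries fun x ↦ hs' n x)
      (fun n x ↦ tsum_nonneg fun k ↦ mul_self_nonneg _) (fun x ↦ ?_) (m := m) fun n x hx ↦ ?_
    · simp_rw [← sq]
      exact tendsto_sum_nat_add fun k ↦ h k x ^ 2
    · simp_rw [← sq]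
      refine le_trans ?_ (hm x hx)
      rw [← (hs x).sum_add_tsum_nat_add n]
      exact le_add_of_nonneg_left (Finset.sum_nonneg fun k _ ↦ sq_nonneg _)

/-- Laplace functionals of random measures that agree after tilting by an independent Gaussian field
agree before tilting. -/
theorem integral_expNeg_eq_of_tiltedLaplace_eq {h : ℕ → X → ℝ} (hh : ∀ k, Measurable (h k))
    (hb : ∀ k, ∃ c, ∀ x, |h k x| ≤ c) (hs : ∀ x, Summable fun k ↦ h k x ^ 2)
    (heq : ∀ f : X → ℝ≥0∞, Measurable f → tiltedLaplace (gaussianSeries h) gaussianSeq κ Q f =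
      tiltedLaplace (gaussianSeries h) gaussianSeq κ' Q' f) {f : X → ℝ≥0∞} (hf : Measurable f)
    {B : ℝ≥0∞} (hB : B ≠ ∞) (hfB : ∀ x, f x ≤ B) :
    ∫ e, expNeg (∫⁻ x, f x ∂κ e) ∂Q = ∫ e, expNeg (∫⁻ x, f x ∂κ' e) ∂Q' := by
  have hV : Measurable fun x ↦ ∑' k, h k x ^ 2 := by fun_prop
  -- The variance `∑ h_k²` is finite at each point but perhaps unbounded. Cutting `f` off to `{∑
  -- h_k² ≤ m}` provides the uniform bound for the limit in `n`; then `m → ∞`.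
  refine tendsto_nhds_unique (tendsto_integral_expNeg_indicator hV hf) ?_
  refine (tendsto_integral_expNeg_indicator hV hf).congr fun m ↦ ?_
  have hfA : Measurable ({x | ∑' k, h k x ^ 2 ≤ m}.indicator f) :=
    hf.indicator (measurableSet_le hV measurable_const)
  have hAB : ∀ x, {x | ∑' k, h k x ^ 2 ≤ m}.indicator f x ≤ B := fun x ↦
    (Set.indicator_le_self _ f x).trans (hfB x)
  have hm : ∀ x, {x | ∑' k, h k x ^ 2 ≤ (m : ℝ)}.indicator f x ≠ 0 → ∑' k, h k x ^ 2 ≤ m :=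
    fun x hx ↦ by
      by_contra hc
      exact hx (Set.indicator_of_notMem (s := {x | ∑' k, h k x ^ 2 ≤ (m : ℝ)}) hc f)
  refine tendsto_nhds_unique (tendsto_tiltedLaplace_gaussianSeries_shift hh hs hfA hB hAB hm) ?_
  refine (tendsto_tiltedLaplace_gaussianSeries_shift hh hs hfA hB hAB hm).congr fun n ↦ ?_
  exact tiltedLaplace_gaussianSeries_shift hh hb hs heq n hfA

end

/-! ### Transfer to the given field and conclusion -/

lemma IsCenteredGaussianField.map {X Ω S : Type*} [MeasurableSpace Ω] [MeasurableSpace S]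
    {P : Measure Ω} {V : Ω → S} (hV : Measurable V) {Ψ : X → S → ℝ}
    (hΨ : ∀ x, Measurable (Ψ x)) {C : X → X → ℝ}
    (h : IsCenteredGaussianField (fun x ω ↦ Ψ x (V ω)) P C) :
    IsCenteredGaussianField Ψ (P.map V) C := by
  intro n x t
  rw [← h, integral_map hV.aemeasurable (Measurable.aestronglyMeasurable (by fun_prop))]

section

variable {X Ω S : Type*} [mX : MeasurableSpace X] [mΩ : MeasurableSpace Ω] [mS : MeasurableSpace S]
  {P : Measure Ω} [IsProbabilityMeasure P]

lemma integral_expNeg_eq_tiltedLaplace_of_indepFun {V : Ω → S} (hV : Measurable V)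
    {Ψ : X → S → ℝ} (hΨ : Measurable (fun p : X × S ↦ Ψ p.1 p.2)) {M : Ω → Measure X}
    (hM : Measurable M) (hfin : ∀ᵐ ω ∂P, IsFiniteMeasure (M ω)) (hind : IndepFun M V P)
    {f : X → ℝ≥0∞} (hf : Measurable f) :
    ∫ ω, expNeg (∫⁻ x, f x * ENNReal.ofReal (Real.exp (Ψ x (V ω))) ∂M ω) ∂P =
      tiltedLaplace Ψ (P.map V) (finiteMeasureKernel X) (P.map M) f := by
  rw [tiltedLaplace, ← (indepFun_iff_map_prod_eq_prod_map_map hM.aemeasurable hV.aemeasurable).1 hind,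
    integral_map (hM.prodMk hV).aemeasurable]
  · refine integral_congr_ae ?_
    filter_upwards [hfin] with ω hω
    rw [finiteMeasureKernel_apply]
  · exact (measurable_expNeg.comp (measurable_lintegral_mul_exp hΨ _ hf)).aestronglyMeasurable

lemma integral_expNeg_eq_tiltedLaplace_gaussianSeries {V : Ω → S} (hV : Measurable V)
    {Ψ : X → S → ℝ} (hΨ : Measurable (fun p : X × S ↦ Ψ p.1 p.2)) {M : Ω → Measure X}
    (hM : Measurable M) (hfin : ∀ᵐ ω ∂P, IsFiniteMeasure (M ω)) (hind : IndepFun M V P)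
    {h : ℕ → X → ℝ} (hh : ∀ k, Measurable (h k)) (hs : ∀ x, Summable fun k ↦ h k x ^ 2)
    (hC : IsCenteredGaussianField (fun x ω ↦ Ψ x (V ω)) P (fun x y ↦ ∑' k, h k x * h k y))
    {f : X → ℝ≥0∞} (hf : Measurable f) :
    ∫ ω, expNeg (∫⁻ x, f x * ENNReal.ofReal (Real.exp (Ψ x (V ω))) ∂M ω) ∂P =
      tiltedLaplace (gaussianSeries h) gaussianSeq (finiteMeasureKernel X) (P.map M) f := by
  have := Measure.isProbabilityMeasure_map (μ := P) hV.aemeasurable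
  have := Measure.isProbabilityMeasure_map (μ := P) hM.aemeasurable
  have hΨx : ∀ x, Measurable (Ψ x) := fun x ↦ hΨ.comp₂ measurable_const measurable_id
  have hG := measurable_gaussianSeries hh
  rw [integral_expNeg_eq_tiltedLaplace_of_indepFun hV hΨ hM hfin hind hf]
  exact tiltedLaplace_eq_of_sameFDD ((hC.map hV hΨx).sameFDD
    (isCenteredGaussianField_gaussianSeries hs) hΨx
    fun x ↦ hG.comp₂ measurable_const measurable_id) hΨ hG hf

/-- The Laplace functional of `e ^ Φ M` for a Gaussian field independent of `M`. -/
theorem FieldIndep.integral_expNeg_expTilt {Φ : X → Ω → ℝ} {M : Ω → Measure X}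
    (hΦM : FieldIndep Φ M P) (hM : Measurable M) (hfin : ∀ᵐ ω ∂P, IsFiniteMeasure (M ω))
    {h : ℕ → X → ℝ} (hh : ∀ k, Measurable (h k)) (hs : ∀ x, Summable fun k ↦ h k x ^ 2)
    (hC : IsCenteredGaussianField Φ P (fun x y ↦ ∑' k, h k x * h k y))
    {f : X → ℝ≥0∞} (hf : Measurable f) :
    ∫ ω, expNeg (∫⁻ x, f x ∂expTilt Φ M ω) ∂P =
      tiltedLaplace (gaussianSeries h) gaussianSeq (finiteMeasureKernel X) (P.map M) f := by
  obtain ⟨𝒢, h𝒢, hΦ, hind⟩ := hΦM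
  -- The source of randomness `V` is the identity of `Ω`, with the smaller σ-algebra `𝒢` on its
  -- target: then the field is jointly measurable in `V`, and `V` is independent of `M`.
  have hid : Measurable[mΩ, 𝒢] (id : Ω → Ω) := measurable_id.mono le_rfl h𝒢
  have hind' : @IndepFun Ω (Measure X) Ω mΩ _ 𝒢 M id P := by
    rw [@IndepFun_iff_Indep _ _ _ _ _ 𝒢, @MeasurableSpace.comap_id _ 𝒢]
    exact hind.symm
  rw [← @integral_expNeg_eq_tiltedLaplace_gaussianSeries X Ω Ω mX mΩ 𝒢 P _ id hid Φ hΦ M hM hfin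
    hind' h hh hs hC f hf]
  congr with ω
  have hΦω : Measurable fun x ↦ Φ x ω :=
    @Measurable.comp₂ X Ω ℝ X mX 𝒢 _ mX Φ hΦ id (fun _ ↦ ω) measurable_id
      (@measurable_const Ω X 𝒢 mX ω)
  rw [expTilt, lintegral_withDensity_eq_lintegral_mul _ (by fun_prop) hf]
  simp only [Pi.mul_apply, mul_comm, id]

/-- Cancellation of an independent Gaussian tilting of random measures on a measurable space. -/
theorem identDistrib_of_identDistrib_expTilt {M M' : Ω → Measure X} (hM : Measurable M)
    (hM' : Measurable M') (hM_fin : ∀ᵐ ω ∂P, IsFiniteMeasure (M ω))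
    (hM'_fin : ∀ᵐ ω ∂P, IsFiniteMeasure (M' ω)) {Φ : X → Ω → ℝ} (hΦM : FieldIndep Φ M P)
    (hΦM' : FieldIndep Φ M' P) {h : ℕ → X → ℝ} (hh : ∀ k, Measurable (h k))
    (hb : ∀ k, ∃ c, ∀ x, |h k x| ≤ c) (hs : ∀ x, Summable fun k ↦ h k x ^ 2)
    (hC : IsCenteredGaussianField Φ P (fun x y ↦ ∑' k, h k x * h k y))
    (hlaw : IdentDistrib (expTilt Φ M) (expTilt Φ M') P P) : IdentDistrib M M' P P := by
  refine ⟨hM.aemeasurable, hM'.aemeasurable, ?_⟩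
  have := Measure.isProbabilityMeasure_map (μ := P) hM.aemeasurable
  have := Measure.isProbabilityMeasure_map (μ := P) hM'.aemeasurable
  -- Sending infinite measures to zero changes nothing almost surely.
  have hK : ∀ {N : Ω → Measure X}, Measurable N → (∀ᵐ ω ∂P, IsFiniteMeasure (N ω)) →
      ∀ f : X → ℝ≥0∞, Measurable f → ∫ ν, expNeg (∫⁻ x, f x ∂finiteMeasureKernel X ν) ∂(P.map N) =
        ∫ ω, expNeg (∫⁻ x, f x ∂N ω) ∂P := fun {N} hN hfin f hf ↦ by
    rw [integral_map hN.aemeasurable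
      (measurable_expNeg_lintegral hf (finiteMeasureKernel X)).aestronglyMeasurable]
    refine integral_congr_ae ?_
    filter_upwards [hfin] with ω hω
    rw [finiteMeasureKernel_apply]
  refine map_eq_map_of_laplace_eq hM hM' fun f hf ⟨B, hB, hfB⟩ ↦ ?_
  rw [← hK hM hM_fin f hf, ← hK hM' hM'_fin f hf]
  refine integral_expNeg_eq_of_tiltedLaplace_eq hh hb hs (fun g hg ↦ ?_) hf hB hfB
  rw [← hΦM.integral_expNeg_expTilt hM hM_fin hh hs hC hg,
    ← hΦM'.integral_expNeg_expTilt hM' hM'_fin hh hs hC hg]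
  exact (hlaw.comp (u := fun ν ↦ expNeg (∫⁻ x, g x ∂ν))
    (measurable_expNeg.comp (Measure.measurable_lintegral hg))).integral_eq

end

theorem theorem3p1 {d : ℕ} (D : Set (EuclideanSpace ℝ (Fin d)))
    (hD_open : IsOpen D) (hD_bdd : Bornology.IsBounded D)
    {Ω : Type*} [MeasurableSpace Ω] (P : Measure Ω) [IsProbabilityMeasure P]
    -- two random a.s.-finite Borel measures on `D`
    (M M' : Ω → Measure D) (hM : Measurable M) (hM' : Measurable M')
    (hM_fin : ∀ᵐ ω ∂P, IsFiniteMeasure (M ω)) (hM'_fin : ∀ᵐ ω ∂P, IsFiniteMeasure (M' ω))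
    -- a centered Gaussian field on `D`, independent of each of the two measures
    (Φ : D → Ω → ℝ) (hΦ_gauss : IsGaussianProcess Φ P) (hΦ_centered : ∀ x, ∫ ω, Φ x ω ∂P = 0)
    (hΦM : FieldIndep Φ M P) (hΦM' : FieldIndep Φ M' P)
    -- whose covariance is a locally uniformly convergent series of products of bounded functions
    (h : ℕ → D → ℝ) (hh_meas : ∀ k, Measurable (h k)) (hh_bdd : ∀ k, ∃ C : ℝ, ∀ x, |h k x| ≤ C)
    (hcov : TendstoLocallyUniformly
      (fun (n : ℕ) (p : D × D) => ∑ k ∈ Finset.range n, h k p.1 * h k p.2)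
      (fun p : D × D => cov[Φ p.1, Φ p.2; P]) atTop)
    -- equality in law of the random measures `e^Φ M` and `e^Φ M'`
    (hlaw : IdentDistrib (expTilt Φ M) (expTilt Φ M') P P) :
    IdentDistrib M M' P P := by
  have hlim : ∀ x y, Tendsto (fun n ↦ ∑ k ∈ Finset.range n, h k x * h k y) atTop
      (𝓝 cov[Φ x, Φ y; P]) := fun x y ↦
    (tendstoLocallyUniformlyOn_univ.2 hcov).tendsto_at (Set.mem_univ (x, y))
  -- On the diagonal the terms are nonnegative, so convergence of the partial sums is summability.
  -- Off the diagonal, absolute summability follows and identifies the covariance with the `tsum`.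
  have hs : ∀ x, Summable fun k ↦ h k x ^ 2 := fun x ↦ by
    simp_rw [sq]
    exact ((hasSum_iff_tendsto_nat_of_nonneg (fun k ↦ mul_self_nonneg _) _).2 (hlim x x)).summable
  have hC : IsCenteredGaussianField Φ P (fun x y ↦ ∑' k, h k x * h k y) := by
    convert IsCenteredGaussianField.of_isGaussianProcess hΦ_gauss hΦ_centered using 3 with x y
    exact tendsto_nhds_unique
      (summable_mul_of_summable_sq (hs x) (hs y)).hasSum.tendsto_sum_nat (hlim x y)
  exact identDistrib_of_identDistrib_expTilt hM hM' hM_fin hM'_fin hΦM hΦM' hh_meas hh_bdd hs hC hlaw
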